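/- For $r>1$ let $D_r=\{(x,y)\in\mathbb{R}^2 : x^2+(y-\frac{r+1}{2})^2<\frac{(r-1)^2}{4}\}$, and let $C_0^\infty(D_r)$ be the set of smooth functions $f:\mathbb{R}^2\to\mathbb{R}$ with compact support contained in $D_r$. For $p>0$ and $\phi\in\mathbb{R}$ put $$\mathcal{D}_1f(p,\phi)=\iint_{D_{1/p,\phi}} f\,\mathrm{d}A,$$ where $D_{d,\phi}$ is the disc of diameter $d$ with centre $\frac d2(\cos\phi,\sin\phi)$, whose boundary passes through the origin, and let $\mathcal{D}_1f(0^+,\phi)=\lim_{p\downarrow 0}\mathcal{D}_1f(p,\phi)$. For $p\in\mathbb{R}$ let $$\mathcal{D}_2f(p,\phi)=\begin{cases}\mathcal{D}_1f(p,\phi), & p>0,\\ \frac12\left(\mathcal{D}_1f(0^+,\phi)+\mathcal{D}_1f(0^+,\phi+\pi)\right), & p=0,\\ \mathcal{D}_1f(-p,\phi+\pi), & p<0,\end{cases}$$ and define the disc transform on $\mathbb{R}\times S^1$ by $$\mathcal{D}f(p,\phi)=\mathcal{D}_2f(p,\phi)+\tfrac12\left(\mathcal{D}_1f(0^+,\phi+\pi)-\mathcal{D}_1f(0^+,\phi)\right)\operatorname{sgn}(p).$$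 Write $\|f\|_{H^\beta}^2=\int_{\mathbb{R}^2}(1+|\xi|^2)^{\beta}|\hat f(\xi)|^2\,\mathrm{d}\xi$ with $\hat f(\xi)=(2\pi)^{-1}\int_{\mathbb{R}^2} f(x)e^{-ix\cdot\xi}\,\mathrm{d}x$, and equip $[-1,1]\times S^1$ with the measure $\mathrm{d}p\,\mathrm{d}\phi$. **Corollary.** Let $r>1$ and $0<\beta<1$. There is a constant $c=c(\beta)>0$ (depending only on $\beta$ and on the fixed domain $D_r$) such that the following holds for all $\rho\ge 0$ and all real $\epsilon$. Let $f\in C_0^\infty(D_r)$, and let $g^\epsilon\in L^2([-1,1]\times S^1)$ be real-valued with $\|g^\epsilon-\mathcal{D}f\|_{L^2([-1,1]\times S^1)}<\epsilon$. Then for any $f_1,f_2\in C_0^\infty(D_r)$ such that $\|\mathcal{D}f_i-g^\epsilon\|_{L^2([-1,1]\times S^1)}<\epsilon$ and $\|f_i\|_{H^\beta}\le\rho$ for $i=1,2$, we have $$\|f_1-f_2\|_{L^2(\mathbb{R}^2)}\le c(\beta)\,\rho^{\frac{3/2}{\beta+3/2}}\,\epsilon^{\frac{\beta}{\beta+3/2}}.$$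 -/

import Mathlib

open MeasureTheory Filter Topology
open scoped ENNReal ContDiff RealInnerProductSpace

noncomputable section

namespace DiscTransform

/-- The Euclidean plane. -/
abbrev Plane : Type := EuclideanSpace ℝ (Fin 2)

/-- The unit vector `(cos φ, sin φ)`. -/
def dir (φ : ℝ) : Plane := !₂[Real.cos φ, Real.sin φ]

/-- The disc whose boundary passes through the origin and whose centre has polar coordinates
`(d / 2, φ)` (so `d` is its diameter). -/
def disc (d φ : ℝ) : Set Plane := Metric.closedBall ((d / 2) • dir φ) (d / 2)

/-- The integral of `f` over the disc of diameter `1 / p` through the origin, for `p > 0`. -/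
def D1 (f : Plane → ℝ) (p φ : ℝ) : ℝ := ∫ x in disc (1 / p) φ, f x

/-- The one-sided limit of `D1 f p φ` as `p` decreases to `0`
(it exists for integrable `f`, see `tendsto_D1_zero`). -/
def D1zero (f : Plane → ℝ) (φ : ℝ) : ℝ := limUnder (𝓝[>] (0 : ℝ)) fun p => D1 f p φ

/-- The extension of `D1 f` to all real `p`. -/
def D2 (f : Plane → ℝ) (p φ : ℝ) : ℝ :=
  if 0 < p then D1 f p φ
  else if p = 0 then (D1zero f φ + D1zero f (φ + Real.pi)) / 2
  else D1 f (-p) (φ + Real.pi)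

/-- Half of the jump of `D2 f` across `p = 0`, with the sign that removes it. -/
def jump (f : Plane → ℝ) (φ : ℝ) : ℝ := (D1zero f (φ + Real.pi) - D1zero f φ) / 2

/-- The disc transform, as a function of `(p, φ)` on the cylinder; it is `2π`-periodic in `φ`. -/
def discTransform (f : Plane → ℝ) (z : ℝ × ℝ) : ℝ :=
  D2 f z.1 z.2 + jump f z.2 * Real.sign z.1

/-- The measure `dp dφ` on `[-1, 1] × S¹`, with `S¹` parametrized by `φ ∈ [0, 2π)`. -/
def cylMeasure : Measure (ℝ × ℝ) :=
  volume.restrict (Set.Icc (-1 : ℝ) 1 ×ˢ Set.Ico (0 : ℝ) (2 * Real.pi))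

/-- The open disc having the segment from `(0, 1)` to `(0, r)` as a diameter. -/
def ringDisc (r : ℝ) : Set Plane :=
  {x | x 0 ^ 2 + (x 1 - (r + 1) / 2) ^ 2 < (r - 1) ^ 2 / 4}

/-- `f ∈ C₀^∞(Ω)`: `f` is smooth, with compact support contained in `Ω`. -/
def IsTestFunction (Ω : Set Plane) (f : Plane → ℝ) : Prop :=
  ContDiff ℝ ∞ f ∧ HasCompactSupport f ∧ tsupport f ⊆ Ω

/-- The unitary Fourier transform `(2π)⁻¹ ∫ f(x) e^{-i x·ξ} dx` on the plane. -/
def fourierPlane (f : Plane → ℝ) (ξ : Plane) : ℂ :=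
  (2 * (Real.pi : ℂ))⁻¹ * ∫ x, (f x : ℂ) * Complex.exp (-Complex.I * (⟪x, ξ⟫ : ℝ))

/-- The Sobolev norm `(∫ (1 + |ξ|²)^α |f̂(ξ)|² dξ)^{1/2}`. -/
def sobolevNorm (α : ℝ) (f : Plane → ℝ) : ℝ≥0∞ :=
  (∫⁻ ξ, ENNReal.ofReal ((1 + ‖ξ‖ ^ 2) ^ α * ‖fourierPlane f ξ‖ ^ 2)) ^ (1 / 2 : ℝ)

theorem norm_dir (φ : ℝ) : ‖dir φ‖ = 1 := by
  simp [dir, EuclideanSpace.norm_eq, Fin.sum_univ_two]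

theorem mem_disc_iff {p : ℝ} (hp : 0 < p) (φ : ℝ) (x : Plane) :
    x ∈ disc (1 / p) φ ↔ p * ‖x‖ ^ 2 ≤ ⟪x, dir φ⟫ := by
  have h0 : (0 : ℝ) ≤ 1 / p / 2 := by positivity
  rw [disc, mem_closedBall_iff_norm, ← sq_le_sq₀ (norm_nonneg _) h0, norm_sub_sq_real,
    inner_smul_right, norm_smul, norm_dir, Real.norm_of_nonneg h0, mul_one]
  have h1 : p * ‖x‖ ^ 2 ≤ ⟪x, dir φ⟫ ↔ ‖x‖ ^ 2 ≤ ⟪x, dir φ⟫ / p := by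
    rw [le_div_iff₀ hp, mul_comm]
  have h2 : 2 * (1 / p / 2 * ⟪x, dir φ⟫) = ⟪x, dir φ⟫ / p := by ring
  rw [h1, h2]
  constructor <;> intro h <;> linarith

/-- The limit defining `D1zero` exists: it is the integral over an open half-plane. -/
theorem tendsto_D1_zero {f : Plane → ℝ} (hf : Integrable f) (φ : ℝ) :
    Tendsto (fun p => D1 f p φ) (𝓝[>] (0 : ℝ)) (𝓝 (∫ x in {x : Plane | 0 < ⟪x, dir φ⟫}, f x)) := by
  have hm : MeasurableSet {x : Plane | 0 < ⟪x, dir φ⟫} :=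
    (isOpen_lt continuous_const (by fun_prop)).measurableSet
  have hd : ∀ d, MeasurableSet (disc d φ) := fun d => Metric.isClosed_closedBall.measurableSet
  simp only [D1, ← integral_indicator hm, ← integral_indicator (hd _)]
  refine tendsto_integral_filter_of_dominated_convergence (fun x => ‖f x‖) ?_ ?_ hf.norm ?_
  · exact Eventually.of_forall fun p => (hf.indicator (hd _)).aestronglyMeasurable
  · exact Eventually.of_forall fun p => Eventually.of_forall fun x => norm_indicator_le_norm_self _ _
  · have h0 : ∀ᵐ x : Plane, x ≠ 0 := by simp [ae_iff]
    filter_upwards [h0] with x hx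
    have hx' : 0 < ‖x‖ ^ 2 := by positivity
    apply tendsto_const_nhds.congr'
    by_cases h : 0 < ⟪x, dir φ⟫
    · have : ∀ᶠ p : ℝ in 𝓝[>] 0, p < ⟪x, dir φ⟫ / ‖x‖ ^ 2 :=
        nhdsWithin_le_nhds (eventually_lt_nhds (by positivity))
      filter_upwards [this, self_mem_nhdsWithin] with p hp hp0
      rw [Set.indicator_of_mem (by exact h), Set.indicator_of_mem]
      rw [mem_disc_iff hp0]
      exact ((lt_div_iff₀ hx').1 hp).le
    · filter_upwards [self_mem_nhdsWithin] with p hp0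
      rw [Set.indicator_of_notMem (by exact h), Set.indicator_of_notMem]
      rw [mem_disc_iff hp0]
      have : 0 < p * ‖x‖ ^ 2 := mul_pos hp0 hx'
      linarith

theorem D1zero_eq {f : Plane → ℝ} (hf : Integrable f) (φ : ℝ) :
    D1zero f φ = ∫ x in {x : Plane | 0 < ⟪x, dir φ⟫}, f x :=
  (tendsto_D1_zero hf φ).limUnder_eq

end DiscTransform

end

/-! The inversion `x ↦ x / |x|²` carries the disc of diameter `1/p` through the origin onto the
half-plane `p ≤ ⟪y, dir φ⟫`. Away from `p = 0`, and up to the sign of `p`, the disc transform is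
therefore a half-plane integral of `pull f`, the density of `f dx` after inversion, plus the term
`jump f φ`, which does not depend on `p`. Half-plane integrals are primitives in `p` of line
integrals, so the Fourier slice theorem takes the form `fourier_pull_dir`: on the ray of direction
`φ`, the Fourier transform of `pull f` at radius `ρ` is the total mass of `f` minus `2πiρ` times the
one-dimensional transform of `signedTransform`.

The jump and the mass are recovered from the data. In every direction the signed transform vanishes
on a `p`-interval of length bounded below (`exists_gap`), where only the jump is seen; in nearly
vertical directions the jump is minus half the mass. With the factor `ρ²` from the slice formula and
`ρ` from polar coordinates, the frequencies `|η| ≤ R` of `pull f` carry energy at most `C R³ ‖𝒟f‖²`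
(`exists_low_frequency_le`).

For the high frequencies, `pull f` is a cutoff of `f` composed with inversion, an operation bounded
on `L²` and on `H¹`. Splitting `f` at frequency `R`, as in real interpolation, bounds the energy
beyond `R` by `C R^(-2β) ‖f‖²` in the `H^β` norm (`exists_tail_transplant_le`).

The sum of the two bounds (`exists_energy_le`), applied to `f₁ - f₂` with `R = (ρ/ε)^(1/(β+3/2))`,
gives the claim when `ε < ρ`; when `ρ ≤ ε` the Sobolev bound alone suffices. -/

noncomputable section

namespace DiscTransform

open scoped FourierTransform SchwartzMap LineDeriv

/-- The integral of the squared norm. -/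
def energy {α E : Type*} [MeasurableSpace α] [NormedAddCommGroup E] (μ : Measure α) (u : α → E) :
    ℝ≥0∞ :=
  ∫⁻ x, ENNReal.ofReal (‖u x‖ ^ 2) ∂μ

/-! ### Squared `L²` norms with values in `ℝ≥0∞`. -/

section Energy

variable {α E F : Type*} [MeasurableSpace α] [NormedAddCommGroup E] [NormedAddCommGroup F]
  {μ : Measure α}

theorem energy_eq_eLpNorm_sq (u : α → E) : energy μ u = eLpNorm u 2 μ ^ 2 := by
  rw [energy, eLpNorm_eq_lintegral_rpow_enorm_toReal (by norm_num) (by norm_num)]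
  rw [← ENNReal.rpow_natCast, ← ENNReal.rpow_mul]
  simp [ENNReal.ofReal_pow]

theorem energy_add_le (u v : α → E) (hu : AEStronglyMeasurable u μ) :
    energy μ (fun x => u x + v x) ≤ 2 * energy μ u + 2 * energy μ v := by
  have hm : AEMeasurable (fun x => ENNReal.ofReal (‖u x‖ ^ 2)) μ :=
    (hu.norm.aemeasurable.pow_const 2).ennreal_ofReal
  rw [energy, energy, energy, ← lintegral_const_mul'' _ hm,
    ← lintegral_const_mul' _ _ (by norm_num), ← lintegral_add_left' (hm.const_mul 2)]
  refine lintegral_mono fun x => ?_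
  have h2 : (2 : ℝ≥0∞) = ENNReal.ofReal 2 := by simp
  rw [h2, ← ENNReal.ofReal_mul (by norm_num), ← ENNReal.ofReal_mul (by norm_num),
    ← ENNReal.ofReal_add (by positivity) (by positivity)]
  refine ENNReal.ofReal_le_ofReal ?_
  have := norm_add_le (u x) (v x)
  nlinarith [norm_nonneg (u x + v x), sq_nonneg (‖u x‖ - ‖v x‖), norm_nonneg (u x),
    norm_nonneg (v x)]

theorem energy_mono_of_le {u : α → E} {v : α → F} {c : ℝ}
    (h : ∀ x, ‖u x‖ ≤ c * ‖v x‖) : energy μ u ≤ ENNReal.ofReal (c ^ 2) * energy μ v := by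
  rw [energy, energy, ← lintegral_const_mul' _ _ ENNReal.ofReal_ne_top]
  refine lintegral_mono fun x => ?_
  rw [← ENNReal.ofReal_mul (by positivity), ← mul_pow]
  exact ENNReal.ofReal_le_ofReal (pow_le_pow_left₀ (norm_nonneg _) (h x) 2)

end Energy

theorem energy_congr {α E F : Type*} [MeasurableSpace α] [NormedAddCommGroup E]
    [NormedAddCommGroup F] {μ : Measure α} {u : α → E} {v : α → F} (h : ∀ x, ‖u x‖ = ‖v x‖) :
    energy μ u = energy μ v := by
  simp [energy, h]

/-! ### Plancherel's identity for the integral Fourier transform. -/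

section Plancherel

variable {V : Type*} [NormedAddCommGroup V] [InnerProductSpace ℝ V] [FiniteDimensional ℝ V]
  [MeasurableSpace V] [BorelSpace V]

/-- The `L²` extension and the Fourier integral have the same pairing with every test function,
because in both cases the transform can be moved onto the test function; hence they agree almost
everywhere. -/
theorem coeFn_fourier_toLp {h : V → ℂ} (h1 : Integrable h) (h2 : MemLp h 2) :
    (𝓕 (h2.toLp h) : Lp ℂ 2 (volume : Measure V)) =ᵐ[volume] 𝓕 h := by
  set u : Lp ℂ 2 (volume : Measure V) := 𝓕 (h2.toLp h) 
  refine ae_eq_of_integral_contDiff_smul_eq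
    ((Lp.memLp u).locallyIntegrable (by norm_num))
    (VectorFourier.fourierIntegral_continuous Real.continuous_fourierChar
      continuous_inner h1).locallyIntegrable ?_
  intro ψ hψ hψc
  have hψ' : ContDiff ℝ ∞ fun x => (ψ x : ℂ) := Complex.ofRealCLM.contDiff.comp hψ
  have hψc' : HasCompactSupport fun x => (ψ x : ℂ) := hψc.comp_left Complex.ofReal_zero
  set Ψ : 𝓢(V, ℂ) := hψc'.toSchwartzMap hψ'
  have hval : ∀ x, Ψ x = (ψ x : ℂ) := fun x => rfl
  have key := congrArg (fun T : 𝓢'(V, ℂ) => T Ψ)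
    (Lp.fourier_toTemperedDistribution_eq (h2.toLp h))
  simp only [TemperedDistribution.fourier_apply, Lp.toTemperedDistribution_apply] at key
  have main : ∫ x, ψ x • u x = ∫ x, ψ x • (𝓕 h) x := calc
    ∫ x, ψ x • u x = ∫ x, Ψ x • u x := by simp [hval]
    _ = ∫ x, (𝓕 Ψ) x • (h2.toLp h) x := key.symm
    _ = ∫ x, (𝓕 Ψ) x • h x := by
      refine integral_congr_ae ?_
      filter_upwards [h2.coeFn_toLp] with x hx
      rw [hx]
    _ = ∫ x, Ψ x • (𝓕 h) x := by
      have := VectorFourier.integral_fourierIntegral_smul_eq_flip (μ := (volume : Measure V))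
        (ν := (volume : Measure V)) (L := innerₗ V) Real.continuous_fourierChar
        continuous_inner Ψ.integrable h1
      simpa using! this
    _ = ∫ x, ψ x • (𝓕 h) x := by
      simp only [hval, Complex.real_smul, smul_eq_mul]
  exact main

/-- Stated on `L¹ ∩ L²` rather than for Schwartz functions because it is also applied to
`signedTransform` in the variable `p`, which is only known to be bounded with bounded support. -/
theorem energy_fourier {h : V → ℂ} (h1 : Integrable h) (h2 : MemLp h 2) :
    energy volume (𝓕 h) = energy volume h := by
  rw [energy_eq_eLpNorm_sq, energy_eq_eLpNorm_sq, ← eLpNorm_congr_ae (coeFn_fourier_toLp h1 h2),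
    ← eLpNorm_congr_ae h2.coeFn_toLp, ← Lp.enorm_def, ← Lp.enorm_def, ← ofReal_norm,
    ← ofReal_norm, Lp.norm_fourier_eq]

theorem energy_fourier_schwartz (h : 𝓢(V, ℂ)) : energy volume (𝓕 (⇑h)) = energy volume h :=
  energy_fourier h.integrable (h.memLp 2 volume)

end Plancherel

/-! ### Dirichlet energy on the Fourier side. -/

section Gradient

theorem norm_sq_eq_coord (x : Plane) : ‖x‖ ^ 2 = x 0 ^ 2 + x 1 ^ 2 := by
  simp [EuclideanSpace.norm_sq_eq, Fin.sum_univ_two]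

theorem norm_apply_single_le (L : Plane →L[ℝ] ℂ) (i : Fin 2) :
    ‖L (EuclideanSpace.single i 1)‖ ≤ ‖L‖ := by
  simpa using L.le_opNorm (EuclideanSpace.single i (1 : ℝ))

/-- Cauchy–Schwarz in coordinates: the operator norm is at most the Hilbert–Schmidt norm. Bounding
each coordinate by the operator norm gives the converse with a factor 2. -/
theorem norm_sq_le_sum_apply_single (L : Plane →L[ℝ] ℂ) :
    ‖L‖ ^ 2 ≤ ‖L (EuclideanSpace.single 0 1)‖ ^ 2 + ‖L (EuclideanSpace.single 1 1)‖ ^ 2 := by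
  set a := ‖L (EuclideanSpace.single 0 1)‖
  set b := ‖L (EuclideanSpace.single 1 1)‖
  have h : ‖L‖ ≤ Real.sqrt (a ^ 2 + b ^ 2) := by
    refine L.opNorm_le_bound (Real.sqrt_nonneg _) fun x => ?_
    have hx : x = x 0 • EuclideanSpace.single 0 (1 : ℝ) + x 1 • EuclideanSpace.single 1 (1 : ℝ) := by
      ext i; fin_cases i <;> simp
    have h1 : ‖L x‖ ≤ |x 0| * a + |x 1| * b := by
      conv_lhs => rw [hx]
      rw [map_add, map_smul, map_smul]
      refine (norm_add_le _ _).trans ?_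
      simp [a, b]
    refine h1.trans (abs_le_of_sq_le_sq' ?_ (by positivity)).2
    rw [mul_pow, Real.sq_sqrt (by positivity), norm_sq_eq_coord, ← sq_abs (x 0), ← sq_abs (x 1)]
    nlinarith [sq_nonneg (a * |x 1| - b * |x 0|)]
  calc ‖L‖ ^ 2 ≤ Real.sqrt (a ^ 2 + b ^ 2) ^ 2 := pow_le_pow_left₀ (norm_nonneg _) h 2
    _ = _ := Real.sq_sqrt (by positivity)

theorem measurable_ofReal_norm_sq (h : 𝓢(Plane, ℂ)) :
    Measurable fun x => ENNReal.ofReal (‖h x‖ ^ 2) :=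
  (h.continuous.norm.pow 2).measurable.ennreal_ofReal

/-- Plancherel, since differentiation along `m` becomes multiplication by `2πi⟪η, m⟫`. -/
theorem energy_lineDeriv (h : 𝓢(Plane, ℂ)) (m : Plane) :
    energy volume (∂_{m} h : 𝓢(Plane, ℂ)) =
      ∫⁻ η, ENNReal.ofReal ((2 * Real.pi * ⟪η, m⟫) ^ 2 * ‖𝓕 (⇑h) η‖ ^ 2) := by
  have : (inner ℝ · m).HasTemperateGrowth := ((innerSL ℝ).flip m).hasTemperateGrowth
  rw [← energy_fourier_schwartz]
  refine lintegral_congr fun η => ?_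
  have hη : 𝓕 (⇑(∂_{m} h : 𝓢(Plane, ℂ))) η =
      (2 * Real.pi * Complex.I) * ((⟪η, m⟫ : ℝ) * 𝓕 (⇑h) η) := by
    rw [← SchwartzMap.fourier_coe, SchwartzMap.fourier_lineDerivOp_eq]
    simp [this, SchwartzMap.fourier_coe]
  rw [hη]
  congr 1
  simp only [norm_mul, Complex.norm_real, Complex.norm_I, mul_pow, Complex.norm_ofNat,
    Real.norm_eq_abs, sq_abs]
  ring

/-- The Dirichlet energy of a Schwartz function in terms of its Fourier transform. -/
theorem lintegral_norm_sq_mul_fourier (h : 𝓢(Plane, ℂ)) :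
    ∫⁻ η, ENNReal.ofReal ((2 * Real.pi * ‖η‖) ^ 2 * ‖𝓕 (⇑h) η‖ ^ 2) =
      energy volume (∂_{(EuclideanSpace.single 0 1 : Plane)} h : 𝓢(Plane, ℂ)) +
        energy volume (∂_{(EuclideanSpace.single 1 1 : Plane)} h : 𝓢(Plane, ℂ)) := by
  have hc : Continuous (𝓕 (⇑h)) := by
    rw [← SchwartzMap.fourier_coe]; exact (𝓕 h).continuous
  have hm : Measurable fun η : Plane => ENNReal.ofReal
      ((2 * Real.pi * ⟪η, (EuclideanSpace.single 0 1 : Plane)⟫) ^ 2 * ‖𝓕 (⇑h) η‖ ^ 2) :=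
    (Continuous.measurable (by fun_prop)).ennreal_ofReal
  rw [energy_lineDeriv, energy_lineDeriv, ← lintegral_add_left hm]
  refine lintegral_congr fun η => ?_
  rw [← ENNReal.ofReal_add (by positivity) (by positivity), mul_pow, norm_sq_eq_coord η]
  have hi (i : Fin 2) : ⟪η, (EuclideanSpace.single i 1 : Plane)⟫ = η i := by
    rw [EuclideanSpace.inner_single_right]; simp
  rw [hi, hi]
  congr 1
  ring

theorem energy_lineDeriv_le (h : 𝓢(Plane, ℂ)) (i : Fin 2) :
    energy volume (∂_{(EuclideanSpace.single i 1 : Plane)} h : 𝓢(Plane, ℂ)) ≤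
      energy volume (fderiv ℝ ⇑h) := by
  refine lintegral_mono fun x => ENNReal.ofReal_le_ofReal ?_
  rw [SchwartzMap.lineDerivOp_apply_eq_fderiv]
  exact pow_le_pow_left₀ (norm_nonneg _) (norm_apply_single_le _ _) 2

theorem energy_fderiv_le (h : 𝓢(Plane, ℂ)) :
    energy volume (fderiv ℝ ⇑h) ≤
      ∫⁻ η, ENNReal.ofReal ((2 * Real.pi * ‖η‖) ^ 2 * ‖𝓕 (⇑h) η‖ ^ 2) := by
  rw [lintegral_norm_sq_mul_fourier, energy, energy, energy,
    ← lintegral_add_left (measurable_ofReal_norm_sq _)]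
  refine lintegral_mono fun x => ?_
  rw [← ENNReal.ofReal_add (by positivity) (by positivity)]
  refine ENNReal.ofReal_le_ofReal ?_
  rw [SchwartzMap.lineDerivOp_apply_eq_fderiv, SchwartzMap.lineDerivOp_apply_eq_fderiv]
  exact norm_sq_le_sum_apply_single _

theorem lintegral_norm_sq_mul_fourier_le (h : 𝓢(Plane, ℂ)) :
    ∫⁻ η, ENNReal.ofReal ((2 * Real.pi * ‖η‖) ^ 2 * ‖𝓕 (⇑h) η‖ ^ 2) ≤
      2 * energy volume (fderiv ℝ ⇑h) := by
  rw [lintegral_norm_sq_mul_fourier, two_mul]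
  exact add_le_add (energy_lineDeriv_le h 0) (energy_lineDeriv_le h 1)

end Gradient

/-! ### Frequency tails and the splitting of an `H^β` function. -/

section HighFrequency

/-- The squared Sobolev norm, in terms of the Fourier transform with kernel `exp (-2πi⟨x, η⟩)`. -/
def sobolevSq (β : ℝ) (f : Plane → ℂ) : ℝ≥0∞ :=
  ∫⁻ η, ENNReal.ofReal ((1 + (2 * Real.pi * ‖η‖) ^ 2) ^ β * ‖𝓕 f η‖ ^ 2)

/-- Chebyshev's inequality: on the tail, `R⁻¹‖η‖` is at least 1 and may be inserted squared. -/
theorem lintegral_tail_fourier_le (h : 𝓢(Plane, ℂ)) {R : ℝ} (hR : 0 < R) :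
    ∫⁻ η in {η : Plane | R < ‖η‖}, ENNReal.ofReal (‖𝓕 (⇑h) η‖ ^ 2) ≤
      ENNReal.ofReal (R⁻¹ ^ 2) * energy volume (fderiv ℝ ⇑h) := by
  have hm : MeasurableSet {η : Plane | R < ‖η‖} :=
    (isOpen_lt continuous_const continuous_norm).measurableSet
  calc ∫⁻ η in {η : Plane | R < ‖η‖}, ENNReal.ofReal (‖𝓕 (⇑h) η‖ ^ 2)
      ≤ ∫⁻ η in {η : Plane | R < ‖η‖}, ENNReal.ofReal (2⁻¹ * R⁻¹ ^ 2) *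
          ENNReal.ofReal ((2 * Real.pi * ‖η‖) ^ 2 * ‖𝓕 (⇑h) η‖ ^ 2) := by
        refine setLIntegral_mono' hm fun η hη => ?_
        rw [← ENNReal.ofReal_mul (by positivity)]
        refine ENNReal.ofReal_le_ofReal ?_
        rw [← mul_assoc]
        refine le_mul_of_one_le_left (by positivity) ?_
        have h1 : 1 ≤ R⁻¹ * ‖η‖ := by
          rw [inv_mul_eq_div, one_le_div hR]; exact (show R < ‖η‖ from hη).le
        -- The surplus `(2π)² ≥ 2` pays for the factor 2 lost in `lintegral_norm_sq_mul_fourier_le`.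
        have h2 : (1 : ℝ) ≤ 2⁻¹ * (2 * Real.pi) ^ 2 := by nlinarith [Real.pi_gt_three]
        have h3 := one_le_mul_of_one_le_of_one_le h2 (one_le_pow₀ h1 (n := 2))
        calc (1 : ℝ) ≤ _ := h3
          _ = _ := by ring
    _ ≤ ∫⁻ η, ENNReal.ofReal (2⁻¹ * R⁻¹ ^ 2) *
          ENNReal.ofReal ((2 * Real.pi * ‖η‖) ^ 2 * ‖𝓕 (⇑h) η‖ ^ 2) :=
        setLIntegral_le_lintegral _ _
    _ ≤ ENNReal.ofReal (2⁻¹ * R⁻¹ ^ 2) * (2 * energy volume (fderiv ℝ ⇑h)) := by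
        rw [lintegral_const_mul' _ _ ENNReal.ofReal_ne_top]
        gcongr
        exact lintegral_norm_sq_mul_fourier_le h
    _ = _ := by
        have h2 : (2 : ℝ≥0∞) = ENNReal.ofReal 2 := by simp
        generalize energy volume (fderiv ℝ ⇑h) = E
        rw [h2, ← mul_assoc, ← ENNReal.ofReal_mul (by positivity)]
        congr 2
        ring

/-- Splitting a Schwartz function into a low-frequency part, which is controlled in `H¹`, and a
high-frequency part, which is small in `L²`. -/
theorem exists_frequency_splitting (f : 𝓢(Plane, ℂ)) {β R : ℝ} (hβ0 : 0 < β) (hβ1 : β < 1)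
    (hR : 1 ≤ R) :
    ∃ u v : 𝓢(Plane, ℂ), f = u + v ∧
      energy volume v ≤ ENNReal.ofReal (R ^ (-2 * β)) * sobolevSq β f ∧
      energy volume u ≤ sobolevSq β f ∧
      energy volume (fderiv ℝ ⇑u) ≤
        ENNReal.ofReal ((4 * Real.pi * R) ^ (2 - 2 * β)) * sobolevSq β f := by
  have hR0 : 0 < R := by linarith
  have hpi := Real.pi_pos
  -- A smooth Fourier multiplier equal to 1 on `‖η‖ ≤ R` and zero for `‖η‖ ≥ 2R`; smoothness keeps
  -- both pieces in the Schwartz class.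
  let B : ContDiffBump (0 : Plane) := ⟨R, 2 * R, hR0, by linarith⟩
  have hBc : HasCompactSupport fun x => (B x : ℂ) :=
    B.hasCompactSupport.comp_left Complex.ofReal_zero
  have hBs : ContDiff ℝ ∞ fun x => (B x : ℂ) := Complex.ofRealCLM.contDiff.comp B.contDiff
  have hBg : (fun x => (B x : ℂ)).HasTemperateGrowth :=
    (hBc.toSchwartzMap hBs).hasTemperateGrowth
  let u : 𝓢(Plane, ℂ) := 𝓕⁻ (SchwartzMap.smulLeftCLM ℂ (fun x => (B x : ℂ)) (𝓕 f))
  have hu : ∀ η, 𝓕 (⇑u) η = B η * 𝓕 (⇑f) η := by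
    intro η
    rw [← SchwartzMap.fourier_coe, ← SchwartzMap.fourier_coe]
    simp only [u, FourierTransform.fourier_fourierInv_eq]
    rw [SchwartzMap.smulLeftCLM_apply_apply hBg, smul_eq_mul]
  have hv : ∀ η, 𝓕 (⇑(f - u)) η = (1 - B η) * 𝓕 (⇑f) η := by
    intro η
    have : 𝓕 (f - u) = 𝓕 f - 𝓕 u := by
      simpa using (FourierTransform.fourierCLM ℂ 𝓢(Plane, ℂ)).map_sub f u
    rw [← SchwartzMap.fourier_coe, this, sub_apply, SchwartzMap.fourier_coe,
      SchwartzMap.fourier_coe, hu]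
    ring
  have hBle : ∀ η, |B η| ≤ 1 := fun η => by rw [abs_of_nonneg B.nonneg]; exact B.le_one
  have hnu : ∀ η, ‖𝓕 (⇑u) η‖ ≤ ‖𝓕 (⇑f) η‖ := by
    intro η
    rw [hu, norm_mul, Complex.norm_real]
    exact mul_le_of_le_one_left (norm_nonneg _) (hBle η)
  have hnu0 : ∀ η, 2 * R ≤ ‖η‖ → 𝓕 (⇑u) η = 0 := by
    intro η hη
    rw [hu, B.zero_of_le_dist (by simpa using hη)]
    simp
  have hnv : ∀ η, ‖𝓕 (⇑(f - u)) η‖ ≤ ‖𝓕 (⇑f) η‖ := by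
    intro η
    rw [hv, norm_mul, ← Complex.ofReal_one, ← Complex.ofReal_sub, Complex.norm_real]
    refine mul_le_of_le_one_left (norm_nonneg _) ?_
    rw [Real.norm_eq_abs, abs_le]
    constructor <;> linarith [B.nonneg (x := η), B.le_one (x := η)]
  have hnv0 : ∀ η, ‖η‖ ≤ R → 𝓕 (⇑(f - u)) η = 0 := by
    intro η hη
    rw [hv, B.one_of_mem_closedBall (by simpa using hη)]
    simp
  refine ⟨u, f - u, by abel, ?_, ?_, ?_⟩
  · rw [← energy_fourier_schwartz, energy, sobolevSq,
      ← lintegral_const_mul' _ _ ENNReal.ofReal_ne_top]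
    refine lintegral_mono fun η => ?_
    rw [← ENNReal.ofReal_mul (by positivity)]
    refine ENNReal.ofReal_le_ofReal ?_
    rcases le_or_gt ‖η‖ R with h | h
    · rw [hnv0 η h]; simp; positivity
    · rw [← mul_assoc]
      have h1 : R ^ (2 * β) ≤ (1 + (2 * Real.pi * ‖η‖) ^ 2) ^ β := by
        rw [Real.rpow_mul hR0.le]
        refine Real.rpow_le_rpow (by positivity) ?_ hβ0.le
        rw [Real.rpow_two]
        have : R ≤ 2 * Real.pi * ‖η‖ := by nlinarith [Real.pi_gt_three]
        nlinarith
      have h2 : 1 ≤ R ^ (-2 * β) * (1 + (2 * Real.pi * ‖η‖) ^ 2) ^ β := by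
        calc (1 : ℝ) = R ^ (-2 * β) * R ^ (2 * β) := by
              rw [← Real.rpow_add hR0]; simp
          _ ≤ _ := by gcongr
      calc ‖𝓕 (⇑(f - u)) η‖ ^ 2 ≤ 1 * ‖𝓕 (⇑f) η‖ ^ 2 := by
            rw [one_mul]; exact pow_le_pow_left₀ (norm_nonneg _) (hnv η) 2
        _ ≤ _ := by gcongr
  · rw [← energy_fourier_schwartz, energy, sobolevSq]
    refine lintegral_mono fun η => ENNReal.ofReal_le_ofReal ?_
    have h2 : 1 ≤ (1 + (2 * Real.pi * ‖η‖) ^ 2) ^ β :=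
      Real.one_le_rpow (by nlinarith [sq_nonneg (2 * Real.pi * ‖η‖)]) hβ0.le
    calc ‖𝓕 (⇑u) η‖ ^ 2 ≤ 1 * ‖𝓕 (⇑f) η‖ ^ 2 := by
          rw [one_mul]; exact pow_le_pow_left₀ (norm_nonneg _) (hnu η) 2
      _ ≤ _ := by gcongr
  · refine (energy_fderiv_le u).trans ?_
    rw [sobolevSq, ← lintegral_const_mul' _ _ ENNReal.ofReal_ne_top]
    refine lintegral_mono fun η => ?_
    rw [← ENNReal.ofReal_mul (by positivity)]
    refine ENNReal.ofReal_le_ofReal ?_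
    rcases le_or_gt (2 * R) ‖η‖ with h | h
    · rw [hnu0 η h]; simp; positivity
    · rw [← mul_assoc]
      have h0 : 0 ≤ 2 * Real.pi * ‖η‖ := by positivity
      -- The exponent 2 is split as `(2 - 2β) + 2β`: the first part is bounded by the cutoff, the
      -- second is absorbed by the Sobolev weight.
      have h1 : (2 * Real.pi * ‖η‖) ^ 2 ≤
          (4 * Real.pi * R) ^ (2 - 2 * β) * (1 + (2 * Real.pi * ‖η‖) ^ 2) ^ β := by
        calc (2 * Real.pi * ‖η‖) ^ 2
            = (2 * Real.pi * ‖η‖) ^ (2 - 2 * β) * ((2 * Real.pi * ‖η‖) ^ 2) ^ β := by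
              rw [← Real.rpow_two, ← Real.rpow_mul h0, ← Real.rpow_add' h0 (by norm_num)]
              congr 1; ring
          _ ≤ _ := by
              have : 0 ≤ 2 - 2 * β := by linarith
              have h2 : 2 * Real.pi * ‖η‖ ≤ 4 * Real.pi * R := by nlinarith
              gcongr
              linarith
      calc (2 * Real.pi * ‖η‖) ^ 2 * ‖𝓕 (⇑u) η‖ ^ 2
          ≤ (2 * Real.pi * ‖η‖) ^ 2 * ‖𝓕 (⇑f) η‖ ^ 2 := by
            gcongr; exact hnu η
        _ ≤ _ := by gcongr

end HighFrequency

/-! ### Inversion in the unit circle: Jacobian, conformality, smoothness. -/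

section Inversion

/-- The inversion in the unit circle. -/
def inv (x : Plane) : Plane := EuclideanGeometry.inversion 0 1 x

theorem inv_eq (x : Plane) : inv x = (‖x‖ ^ 2)⁻¹ • x := by
  simp [inv, EuclideanGeometry.inversion]

theorem inv_zero : inv 0 = 0 := by simp [inv_eq]

theorem inv_inv (x : Plane) : inv (inv x) = x :=
  EuclideanGeometry.inversion_inversion 0 one_ne_zero x

theorem norm_inv (x : Plane) : ‖inv x‖ = ‖x‖⁻¹ := by
  have := EuclideanGeometry.dist_inversion_center (0 : Plane) x 1
  simpa [inv] using this

theorem inv_injective : Function.Injective inv :=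
  EuclideanGeometry.inversion_injective 0 one_ne_zero

theorem inv_image_compl_zero : inv '' {0}ᶜ = {0}ᶜ := by
  ext x
  constructor
  · rintro ⟨y, hy, rfl⟩ h
    exact hy (inv_injective (by rw [Set.mem_singleton_iff.1 h, inv_zero]))
  · intro hx
    refine ⟨inv x, fun h => hx ?_, inv_inv x⟩
    rw [Set.mem_singleton_iff] at h ⊢
    rw [← inv_inv x, h, inv_zero]

theorem hasFDerivAt_inv {x : Plane} (hx : x ≠ 0) :
    HasFDerivAt inv ((1 / ‖x‖) ^ 2 • ((ℝ ∙ x)ᗮ.reflection : Plane →L[ℝ] Plane)) x := by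
  have := EuclideanGeometry.hasFDerivAt_inversion (c := (0 : Plane)) (R := 1) hx
  simpa using! this

/-- The derivative is a reflection, of determinant `±1`, scaled by `‖x‖⁻²`, and the scale enters
squared in dimension 2. -/
theorem abs_det_fderiv_inv (x : Plane) :
    |((1 / ‖x‖) ^ 2 • ((ℝ ∙ x)ᗮ.reflection : Plane →L[ℝ] Plane)).det| = ‖x‖⁻¹ ^ 4 := by
  have h1 : |LinearMap.det (((ℝ ∙ x)ᗮ.reflection.toLinearEquiv : Plane ≃ₗ[ℝ] Plane) :
      Plane →ₗ[ℝ] Plane)| = 1 := by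
    have := congrArg abs (Submodule.det_reflection (𝕜 := ℝ) (ℝ ∙ x)ᗮ)
    rw [abs_pow, abs_neg, abs_one, one_pow] at this
    exact this
  have h2 : ((1 / ‖x‖) ^ 2 • ((ℝ ∙ x)ᗮ.reflection : Plane →L[ℝ] Plane)).det =
      ((1 / ‖x‖) ^ 2) ^ 2 * LinearMap.det (((ℝ ∙ x)ᗮ.reflection.toLinearEquiv :
        Plane ≃ₗ[ℝ] Plane) : Plane →ₗ[ℝ] Plane) := by
    have := LinearMap.det_smul ((1 / ‖x‖) ^ 2)
      (((ℝ ∙ x)ᗮ.reflection.toLinearEquiv : Plane ≃ₗ[ℝ] Plane) : Plane →ₗ[ℝ] Plane)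
    rw [finrank_euclideanSpace, Fintype.card_fin] at this
    exact this
  rw [h2, abs_mul, h1, mul_one, abs_of_nonneg (by positivity), one_div, ← pow_mul]

theorem measurableSet_compl_zero : MeasurableSet ({0}ᶜ : Set Plane) :=
  (measurableSet_singleton 0).compl

theorem restrict_compl_zero : (volume : Measure Plane).restrict {0}ᶜ = volume :=
  Measure.restrict_eq_self_of_ae_mem (by simp [ae_iff])

/-- Change of variables on the punctured plane, which inversion maps onto itself; the origin is a
null set. -/
theorem lintegral_comp_inv (F : Plane → ℝ≥0∞) :
    ∫⁻ x, ENNReal.ofReal (‖x‖⁻¹ ^ 4) * F (inv x) = ∫⁻ y, F y := by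
  have := lintegral_image_eq_lintegral_abs_det_fderiv_mul volume measurableSet_compl_zero
    (fun x hx => (hasFDerivAt_inv hx).hasFDerivWithinAt) inv_injective.injOn F
  rw [inv_image_compl_zero, restrict_compl_zero] at this
  simpa only [abs_det_fderiv_inv] using this.symm

theorem integral_comp_inv {E : Type*} [NormedAddCommGroup E] [NormedSpace ℝ E] (F : Plane → E) :
    ∫ x, (‖x‖⁻¹ ^ 4) • F (inv x) = ∫ y, F y := by
  have := integral_image_eq_integral_abs_det_fderiv_smul volume measurableSet_compl_zero
    (fun x hx => (hasFDerivAt_inv hx).hasFDerivWithinAt) inv_injective.injOn F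
  rw [inv_image_compl_zero, restrict_compl_zero] at this
  simpa only [abs_det_fderiv_inv] using this.symm

theorem norm_fderiv_comp_inv_le {v : Plane → ℂ} (hv : ContDiff ℝ ∞ v) {y : Plane} (hy : y ≠ 0) :
    ‖fderiv ℝ (v ∘ inv) y‖ ≤ ‖y‖⁻¹ ^ 2 * ‖fderiv ℝ v (inv y)‖ := by
  have hd := ((hv.differentiable (by simp)).differentiableAt (x := inv y)).hasFDerivAt.comp y
    (hasFDerivAt_inv hy)
  rw [hd.fderiv]
  refine (ContinuousLinearMap.opNorm_comp_le _ _).trans ?_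
  rw [mul_comm]
  gcongr
  rw [norm_smul, one_div, Real.norm_of_nonneg (by positivity)]
  refine mul_le_of_le_one_right (by positivity) ?_
  exact LinearIsometry.norm_toContinuousLinearMap_le (ℝ ∙ y)ᗮ.reflection.toLinearIsometry

/-- The Dirichlet energy in the plane does not increase under inversion. -/
theorem energy_fderiv_comp_inv_le {v : Plane → ℂ} (hv : ContDiff ℝ ∞ v) :
    energy volume (fderiv ℝ (v ∘ inv)) ≤ energy volume (fderiv ℝ v) := by
  rw [energy, energy, ← lintegral_comp_inv fun y => ENNReal.ofReal (‖fderiv ℝ v y‖ ^ 2)]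
  refine lintegral_mono_ae ?_
  have h0 : ∀ᵐ x : Plane, x ≠ 0 := by simp [ae_iff]
  filter_upwards [h0] with y hy
  rw [← ENNReal.ofReal_mul (by positivity)]
  refine ENNReal.ofReal_le_ofReal ?_
  -- The squared conformal factor `‖y‖⁻⁴` is exactly the Jacobian of the inversion: conformal
  -- invariance of the Dirichlet integral in dimension 2.
  calc ‖fderiv ℝ (v ∘ inv) y‖ ^ 2 ≤ (‖y‖⁻¹ ^ 2 * ‖fderiv ℝ v (inv y)‖) ^ 2 :=
        pow_le_pow_left₀ (norm_nonneg _) (norm_fderiv_comp_inv_le hv hy) 2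
    _ = _ := by ring

/-- After the change of variables the Jacobian `‖x‖⁻⁴` is evaluated only where `v` is nonzero, so it
is at most `δ⁻⁴`. -/
theorem energy_comp_inv_le {v : Plane → ℂ} {δ : ℝ} (hδ : 0 < δ) (hv : ∀ x, v x ≠ 0 → δ ≤ ‖x‖) :
    energy volume (v ∘ inv) ≤ ENNReal.ofReal (δ⁻¹ ^ 4) * energy volume v := by
  rw [energy, ← lintegral_comp_inv, energy, ← lintegral_const_mul' _ _ ENNReal.ofReal_ne_top]
  refine lintegral_mono fun x => ?_
  rw [Function.comp_apply, inv_inv, ← ENNReal.ofReal_mul (by positivity),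
    ← ENNReal.ofReal_mul (by positivity)]
  refine ENNReal.ofReal_le_ofReal ?_
  rcases eq_or_ne (v x) 0 with h | h
  · simp [h]
  · have := hv x h
    gcongr

theorem continuousOn_inv : ContinuousOn inv {0}ᶜ := fun _ hx =>
  (hasFDerivAt_inv hx).continuousAt.continuousWithinAt

theorem comp_inv_eq_zero {v : Plane → ℂ} {y : Plane} (hy : y ∉ inv '' tsupport v) :
    (v ∘ inv) y = 0 := by
  refine image_eq_zero_of_notMem_tsupport (f := v) fun h => hy ⟨inv y, h, inv_inv y⟩

theorem isCompact_inv_image {v : Plane → ℂ} (hc : HasCompactSupport v) (h0 : 0 ∉ tsupport v) :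
    IsCompact (inv '' tsupport v) :=
  hc.isCompact.image_of_continuousOn (continuousOn_inv.mono fun _ hx h => h0 (h ▸ hx))

theorem hasCompactSupport_comp_inv {v : Plane → ℂ} (hc : HasCompactSupport v)
    (h0 : 0 ∉ tsupport v) : HasCompactSupport (v ∘ inv) :=
  HasCompactSupport.intro (isCompact_inv_image hc h0) fun _ hy => comp_inv_eq_zero hy

/-- Only the origin is in question, where `inv` is not smooth. The inverted support is compact and
misses 0, so the composite vanishes in a neighbourhood of 0. -/
theorem contDiff_comp_inv {v : Plane → ℂ} (hv : ContDiff ℝ ∞ v) (hc : HasCompactSupport v)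
    (h0 : 0 ∉ tsupport v) : ContDiff ℝ ∞ (v ∘ inv) := by
  rw [contDiff_iff_contDiffAt]
  intro y
  rcases eq_or_ne y 0 with rfl | hy
  · have h1 : (inv '' tsupport v)ᶜ ∈ 𝓝 (0 : Plane) := by
      refine (isCompact_inv_image hc h0).isClosed.isOpen_compl.mem_nhds ?_
      rintro ⟨x, hx, h⟩
      rw [← inv_zero] at h
      exact h0 (inv_injective h ▸ hx)
    refine (contDiffAt_const (c := (0 : ℂ))).congr_of_eventuallyEq ?_
    filter_upwards [h1] with x hx using comp_inv_eq_zero hx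
  · refine hv.contDiffAt.comp y ?_
    exact ContDiffAt.inversion contDiffAt_const contDiffAt_const contDiffAt_id hy

end Inversion

/-! ### Cutoff followed by inversion, on `L²`, `H¹` and, by interpolation, `H^β`. -/

section Transplant

theorem mul_schwartz_contDiff {w : Plane → ℝ} (hw : ContDiff ℝ ∞ w) (u : 𝓢(Plane, ℂ)) :
    ContDiff ℝ ∞ fun x => w x • u x :=
  hw.smul (u.smooth ⊤)

/-- Multiplication of a Schwartz function by a cutoff supported away from the origin, followed
by inversion. -/
def transplant {w : Plane → ℝ} (hw : ContDiff ℝ ∞ w) (hc : HasCompactSupport w)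
    (h0 : 0 ∉ tsupport w) (u : 𝓢(Plane, ℂ)) : 𝓢(Plane, ℂ) :=
  have hc' : HasCompactSupport fun x => w x • u x := hc.smul_right
  have h0' : 0 ∉ tsupport fun x => w x • u x := fun h => h0 (tsupport_smul_subset_left w u h)
  (hasCompactSupport_comp_inv hc' h0').toSchwartzMap
    (contDiff_comp_inv (mul_schwartz_contDiff hw u) hc' h0')

theorem coe_transplant {w : Plane → ℝ} (hw : ContDiff ℝ ∞ w) (hc : HasCompactSupport w)
    (h0 : 0 ∉ tsupport w) (u : 𝓢(Plane, ℂ)) :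
    ⇑(transplant hw hc h0 u) = (fun x => w x • u x) ∘ inv := rfl

/-- Boundedness of the transplantation in `L²` and in `H¹`. -/
theorem exists_transplant_bound {w : Plane → ℝ} (hw : ContDiff ℝ ∞ w) (hc : HasCompactSupport w)
    (h0 : 0 ∉ tsupport w) : ∃ C : ℝ, 0 ≤ C ∧ ∀ u : 𝓢(Plane, ℂ),
      energy volume (transplant hw hc h0 u) ≤ ENNReal.ofReal C * energy volume u ∧
      energy volume (fderiv ℝ ⇑(transplant hw hc h0 u)) ≤
        ENNReal.ofReal C * (energy volume u + energy volume (fderiv ℝ ⇑u)) := by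
  obtain ⟨A, hA⟩ := hc.exists_bound_of_continuous hw.continuous
  obtain ⟨A', hA'⟩ := (hc.fderiv (𝕜 := ℝ)).exists_bound_of_continuous
    (hw.continuous_fderiv (by simp))
  have hA0 : 0 ≤ A := (norm_nonneg _).trans (hA 0)
  have hA0' : 0 ≤ A' := (norm_nonneg _).trans (hA' 0)
  -- A ball around the origin that avoids the support of `w`; it bounds the Jacobian in the `L²`
  -- estimate.
  obtain ⟨δ, hδ, hball⟩ := Metric.isOpen_iff.1 (isClosed_tsupport w).isOpen_compl 0 h0
  have hδw : ∀ x, w x ≠ 0 → δ ≤ ‖x‖ := by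
    intro x hx
    by_contra! h
    exact hball (by simpa using h) (subset_tsupport w hx)
  have h2 : (2 : ℝ≥0∞) = ENNReal.ofReal 2 := by simp
  refine ⟨δ⁻¹ ^ 4 * A ^ 2 + 2 * A' ^ 2 + 2 * A ^ 2, by positivity, fun u => ⟨?_, ?_⟩⟩
  · rw [coe_transplant]
    refine (energy_comp_inv_le hδ fun x hx => hδw x fun h => hx (by simp [h])).trans ?_
    calc ENNReal.ofReal (δ⁻¹ ^ 4) * energy volume (fun x => w x • u x)
        ≤ ENNReal.ofReal (δ⁻¹ ^ 4) * (ENNReal.ofReal (A ^ 2) * energy volume u) := by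
          gcongr
          refine energy_mono_of_le fun x => ?_
          rw [norm_smul]
          gcongr
          exact hA x
      _ = ENNReal.ofReal (δ⁻¹ ^ 4 * A ^ 2) * energy volume u := by
          rw [← mul_assoc, ← ENNReal.ofReal_mul (by positivity)]
      _ ≤ _ := by
          gcongr
          nlinarith [sq_nonneg A, sq_nonneg A']
  · rw [coe_transplant]
    refine (energy_fderiv_comp_inv_le (mul_schwartz_contDiff hw u)).trans ?_
    -- By the product rule, the term in which the derivative falls on `w` costs only the `L²` energy
    -- of `u`.
    have hfd : fderiv ℝ (fun x => w x • u x) =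
        fun x => (fderiv ℝ w x).smulRight (u x) + w x • fderiv ℝ (⇑u) x := by
      ext1 x
      rw [fderiv_fun_smul (hw.differentiable (by simp)).differentiableAt u.differentiableAt,
        add_comm]
    rw [hfd]
    have hcont : Continuous fun x => (fderiv ℝ w x).smulRight (u x) :=
      (ContinuousLinearMap.smulRightL ℝ Plane ℂ).continuous₂.comp
        ((hw.continuous_fderiv (by simp)).prodMk u.continuous)
    refine (energy_add_le _ _ hcont.aestronglyMeasurable).trans ?_
    have e1 : energy volume (fun x => (fderiv ℝ w x).smulRight (u x)) ≤
        ENNReal.ofReal (A' ^ 2) * energy volume u := by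
      refine energy_mono_of_le fun x => ?_
      rw [ContinuousLinearMap.norm_smulRight_apply]
      gcongr
      exact hA' x
    have e2 : energy volume (fun x => w x • fderiv ℝ (⇑u) x) ≤
        ENNReal.ofReal (A ^ 2) * energy volume (fderiv ℝ ⇑u) := by
      refine energy_mono_of_le fun x => ?_
      rw [norm_smul]
      gcongr
      exact hA x
    generalize energy volume (fun x => (fderiv ℝ w x).smulRight (u x)) = E1 at *
    generalize energy volume (fun x => w x • fderiv ℝ (⇑u) x) = E2 at *
    generalize energy volume (⇑u) = E3 at *
    generalize energy volume (fderiv ℝ ⇑u) = E4 at *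
    rw [mul_add, h2]
    calc ENNReal.ofReal 2 * E1 + ENNReal.ofReal 2 * E2
        ≤ ENNReal.ofReal 2 * (ENNReal.ofReal (A' ^ 2) * E3) +
          ENNReal.ofReal 2 * (ENNReal.ofReal (A ^ 2) * E4) := by gcongr
      _ = ENNReal.ofReal (2 * A' ^ 2) * E3 + ENNReal.ofReal (2 * A ^ 2) * E4 := by
          rw [← mul_assoc, ← mul_assoc, ← ENNReal.ofReal_mul (by positivity),
            ← ENNReal.ofReal_mul (by positivity)]
      _ ≤ _ := by
          have : 0 ≤ δ⁻¹ ^ 4 * A ^ 2 := by positivity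
          gcongr <;> nlinarith [sq_nonneg A, sq_nonneg A']

/-- High-frequency decay of transplanted functions. -/
theorem exists_tail_transplant_le {w : Plane → ℝ} (hw : ContDiff ℝ ∞ w)
    (hc : HasCompactSupport w) (h0 : 0 ∉ tsupport w) {β : ℝ} (hβ0 : 0 < β) (hβ1 : β < 1) :
    ∃ C : ℝ, 0 ≤ C ∧ ∀ (f : 𝓢(Plane, ℂ)) (R : ℝ), 1 ≤ R →
      ∫⁻ η in {η : Plane | R < ‖η‖}, ENNReal.ofReal (‖𝓕 (⇑(transplant hw hc h0 f)) η‖ ^ 2) ≤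
        ENNReal.ofReal (C * R ^ (-2 * β)) * sobolevSq β f := by
  obtain ⟨C, hC, hbound⟩ := exists_transplant_bound hw hc h0
  have hpi := Real.pi_pos
  set D : ℝ := (4 * Real.pi) ^ (2 - 2 * β)
  have hD0 : 0 ≤ D := by positivity
  refine ⟨2 * (C * (1 + D)) + 2 * C, by positivity, fun f R hR => ?_⟩
  have hR0 : 0 < R := by linarith
  -- The splitting frequency is the tail threshold `R` itself. The smooth part then contributes `R⁻²
  -- · R^(2-2β)` through its gradient and the rough part `R^(-2β)` through its `L²` norm, so both
  -- have the same order.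
  obtain ⟨u, v, huv, hv, hu, hdu⟩ := exists_frequency_splitting f hβ0 hβ1 hR
  have hadd : transplant hw hc h0 f = transplant hw hc h0 u + transplant hw hc h0 v := by
    ext y
    simp [coe_transplant, huv]
  have hF : ∀ η, 𝓕 (⇑(transplant hw hc h0 f)) η =
      𝓕 (⇑(transplant hw hc h0 u)) η + 𝓕 (⇑(transplant hw hc h0 v)) η := by
    intro η
    rw [hadd]
    have : 𝓕 (transplant hw hc h0 u + transplant hw hc h0 v) =
        𝓕 (transplant hw hc h0 u) + 𝓕 (transplant hw hc h0 v) := by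
      simp
    rw [← SchwartzMap.fourier_coe, this, add_apply, SchwartzMap.fourier_coe,
      SchwartzMap.fourier_coe]
  have hcont : Continuous (𝓕 (⇑(transplant hw hc h0 u))) := by
    rw [← SchwartzMap.fourier_coe]; exact SchwartzMap.continuous _
  set S := sobolevSq β f
  have t1 : ∫⁻ η in {η : Plane | R < ‖η‖},
      ENNReal.ofReal (‖𝓕 (⇑(transplant hw hc h0 u)) η‖ ^ 2) ≤
        ENNReal.ofReal (C * (1 + D) * R ^ (-2 * β)) * S := by
    refine (lintegral_tail_fourier_le _ hR0).trans ?_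
    calc _ ≤ ENNReal.ofReal (R⁻¹ ^ 2) * (ENNReal.ofReal C *
            (S + ENNReal.ofReal ((4 * Real.pi * R) ^ (2 - 2 * β)) * S)) := by
          gcongr
          refine (hbound u).2.trans ?_
          gcongr
      _ = ENNReal.ofReal (R⁻¹ ^ 2 * C * (1 + (4 * Real.pi * R) ^ (2 - 2 * β))) * S := by
          rw [ENNReal.ofReal_mul (by positivity), ENNReal.ofReal_mul (by positivity),
            ENNReal.ofReal_add (by positivity) (by positivity), ENNReal.ofReal_one]
          ring
      _ ≤ _ := by
          refine mul_le_mul_left (ENNReal.ofReal_le_ofReal ?_) S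
          have hp : (4 * Real.pi * R) ^ (2 - 2 * β) = D * R ^ (2 - 2 * β) := by
            rw [Real.mul_rpow (by positivity) hR0.le]
          have h1 : 1 ≤ R ^ (2 - 2 * β) := Real.one_le_rpow hR (by linarith)
          have h2 : R ^ (-2 * β) = R⁻¹ ^ 2 * R ^ (2 - 2 * β) := by
            rw [inv_pow, ← Real.rpow_natCast, ← Real.rpow_neg hR0.le, ← Real.rpow_add hR0]
            congr 1
            push_cast
            ring
          rw [hp, h2]
          calc R⁻¹ ^ 2 * C * (1 + D * R ^ (2 - 2 * β))
              ≤ R⁻¹ ^ 2 * C * (R ^ (2 - 2 * β) + D * R ^ (2 - 2 * β)) := by gcongr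
            _ = _ := by ring
  have t2 : ∫⁻ η in {η : Plane | R < ‖η‖},
      ENNReal.ofReal (‖𝓕 (⇑(transplant hw hc h0 v)) η‖ ^ 2) ≤
        ENNReal.ofReal (C * R ^ (-2 * β)) * S := by
    refine (setLIntegral_le_lintegral _ _).trans ?_
    refine (energy_fourier_schwartz _).le.trans ((hbound v).1.trans ?_)
    rw [ENNReal.ofReal_mul hC, mul_assoc]
    gcongr
  have t3 := energy_add_le (μ := volume.restrict {η : Plane | R < ‖η‖})
    (𝓕 (⇑(transplant hw hc h0 u))) (𝓕 (⇑(transplant hw hc h0 v))) hcont.aestronglyMeasurable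
  simp only [hF]
  refine t3.trans ((add_le_add (mul_le_mul_right t1 2) (mul_le_mul_right t2 2)).trans ?_)
  have h2 : (2 : ℝ≥0∞) = ENNReal.ofReal 2 := by simp
  rw [h2, ← mul_assoc, ← mul_assoc, ← ENNReal.ofReal_mul (by positivity),
    ← ENNReal.ofReal_mul (by positivity), ← add_mul,
    ← ENNReal.ofReal_add (by positivity) (by positivity)]
  gcongr
  apply le_of_eq
  ring

end Transplant

/-! ### Half-planes, discs through the origin, and the inverted support disc. -/

section Geometry

theorem dir_add_pi (φ : ℝ) : dir (φ + Real.pi) = -dir φ := by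
  ext i
  fin_cases i <;> simp [dir]

theorem inner_dir (x : Plane) (φ : ℝ) : ⟪x, dir φ⟫ = x 0 * Real.cos φ + x 1 * Real.sin φ := by
  simp [dir, PiLp.inner_apply, Fin.sum_univ_two]
  ring

theorem inner_inv_dir (x : Plane) (φ : ℝ) : ⟪inv x, dir φ⟫ = (‖x‖ ^ 2)⁻¹ * ⟪x, dir φ⟫ := by
  rw [inv_eq, real_inner_smul_left]

/-- Combined with `mem_disc_iff`, this is the statement that inversion straightens discs through the
origin into half-planes. -/
theorem le_inner_inv_dir_iff {x : Plane} (hx : x ≠ 0) (p φ : ℝ) :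
    p ≤ ⟪inv x, dir φ⟫ ↔ p * ‖x‖ ^ 2 ≤ ⟪x, dir φ⟫ := by
  have h : 0 < ‖x‖ ^ 2 := by positivity
  rw [inner_inv_dir, inv_mul_eq_div, le_div_iff₀ h]

theorem abs_inner_inv_dir_le (x : Plane) (φ : ℝ) : |⟪inv x, dir φ⟫| ≤ ‖x‖⁻¹ := by
  simpa [norm_dir, norm_inv] using abs_real_inner_le_norm (inv x) (dir φ)

variable {r : ℝ} {x : Plane}

theorem one_lt_apply_one_of_mem_ringDisc (hr : 1 < r) (hx : x ∈ ringDisc r) : 1 < x 1 := by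
  have h : x 0 ^ 2 + (x 1 - (r + 1) / 2) ^ 2 < (r - 1) ^ 2 / 4 := hx
  nlinarith [sq_nonneg (x 0), abs_lt_of_sq_lt_sq' (show (x 1 - (r + 1) / 2) ^ 2 < ((r - 1) / 2) ^ 2
    by nlinarith [sq_nonneg (x 0)]) (by linarith)]

theorem abs_apply_zero_lt_of_mem_ringDisc (hr : 1 < r) (hx : x ∈ ringDisc r) : |x 0| < r := by
  have h : x 0 ^ 2 + (x 1 - (r + 1) / 2) ^ 2 < (r - 1) ^ 2 / 4 := hx
  have := abs_lt_of_sq_lt_sq (show (x 0) ^ 2 < ((r - 1) / 2) ^ 2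
    by nlinarith [sq_nonneg (x 1 - (r + 1) / 2)]) (by linarith)
  linarith

theorem one_lt_norm_of_mem_ringDisc (hr : 1 < r) (hx : x ∈ ringDisc r) : 1 < ‖x‖ := by
  have h := one_lt_apply_one_of_mem_ringDisc hr hx
  have h2 := norm_sq_eq_coord x
  nlinarith [norm_nonneg x, sq_nonneg (x 0)]

theorem ne_zero_of_mem_ringDisc (hr : 1 < r) (hx : x ∈ ringDisc r) : x ≠ 0 := by
  rintro rfl
  have := one_lt_norm_of_mem_ringDisc hr hx
  simp at this
  linarith

/-- In nearly vertical directions the whole support disc lies on one side of the line through the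
origin: `|x 0| < r` and `1 < x 1` make the sine term dominate. -/
theorem inner_dir_pos_of_mem_ringDisc (hr : 1 < r) (hx : x ∈ ringDisc r) {φ : ℝ}
    (hφ : r * |Real.cos φ| ≤ Real.sin φ) : 0 < ⟪x, dir φ⟫ := by
  have h1 := one_lt_apply_one_of_mem_ringDisc hr hx
  have h0 := abs_apply_zero_lt_of_mem_ringDisc hr hx
  have hs : 0 < Real.sin φ := by
    refine lt_of_le_of_ne ((by positivity : 0 ≤ r * |Real.cos φ|).trans hφ) fun h => ?_
    have hc : |Real.cos φ| = 0 := by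
      rw [← h] at hφ
      exact le_antisymm (nonpos_of_mul_nonpos_right hφ (by linarith)) (abs_nonneg _)
    have := Real.sin_sq_add_cos_sq φ
    rw [abs_eq_zero.1 hc, ← h] at this
    norm_num at this
  rw [inner_dir]
  have h2 : -(|x 0| * |Real.cos φ|) ≤ x 0 * Real.cos φ := by
    rw [← abs_mul]; exact neg_abs_le _
  have h3 : |x 0| * |Real.cos φ| ≤ Real.sin φ :=
    (mul_le_mul_of_nonneg_right h0.le (abs_nonneg _)).trans hφ
  nlinarith

/-- Inversion maps the support disc to the disc with centre `(0, m)` and radius `q`, where `m + q =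
1`. Its projection to direction `φ` is bounded by `q + m|sin φ| = 1 - m(1 - |sin φ|)`, and the
hypothesis keeps `|sin φ|` away from 1. -/
theorem abs_inner_inv_dir_le_of_mem_ringDisc (hr : 1 < r) (hx : x ∈ ringDisc r) {φ : ℝ}
    (hφ : |Real.sin φ| < r * |Real.cos φ|) :
    |⟪inv x, dir φ⟫| ≤ 1 - (4 * (1 + r ^ 2))⁻¹ := by
  have h : x 0 ^ 2 + (x 1 - (r + 1) / 2) ^ 2 < (r - 1) ^ 2 / 4 := hx
  have hx0 := ne_zero_of_mem_ringDisc hr hx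
  have hn : 0 < ‖x‖ ^ 2 := by positivity
  rw [inner_inv_dir, abs_mul, abs_of_pos (inv_pos.2 hn), inv_mul_le_iff₀ hn]
  have hnx := norm_sq_eq_coord x
  set n := ‖x‖ ^ 2
  set c := Real.cos φ
  set s := Real.sin φ
  have hcs : s ^ 2 + c ^ 2 = 1 := Real.sin_sq_add_cos_sq φ
  -- the centre and the radius of the inverted disc
  set m : ℝ := (1 + r⁻¹) / 2 with hm
  set q : ℝ := (1 - r⁻¹) / 2 with hq
  have hr0 : 0 < r := by linarith
  have hri : r⁻¹ < 1 := inv_lt_one_of_one_lt₀ hr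
  have hri0 : 0 < r⁻¹ := inv_pos.2 hr0
  have hmq : m ^ 2 - q ^ 2 = r⁻¹ := by rw [hm, hq]; ring
  have hkey : 1 - 2 * m * x 1 + r⁻¹ * n ≤ 0 := by
    have h1 : n + r - (r + 1) * x 1 < 0 := by rw [hnx]; nlinarith
    have h2 : r⁻¹ * (n + r - (r + 1) * x 1) < 0 := mul_neg_of_pos_of_neg hri0 h1
    have h3 : r⁻¹ * r = 1 := inv_mul_cancel₀ hr0.ne'
    have h4 : r⁻¹ * (n + r - (r + 1) * x 1) = 1 - 2 * m * x 1 + r⁻¹ * n := by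
      rw [hm]; linear_combination (1 - x 1) * h3
    linarith
  -- Membership of `inv x` in the inverted disc, multiplied by `n²` to avoid division.
  have hdist : (x 0) ^ 2 + (x 1 - m * n) ^ 2 ≤ (q * n) ^ 2 := by
    have : (x 0) ^ 2 + (x 1 - m * n) ^ 2 - (q * n) ^ 2 = n * (1 - 2 * m * x 1 + r⁻¹ * n) := by
      rw [← hmq]; linear_combination -hnx
    nlinarith
  have hproj : |x 0 * c + (x 1 - m * n) * s| ≤ q * n := by
    refine abs_le_of_sq_le_sq ?_ (mul_nonneg (by rw [hq]; linarith) hn.le)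
    refine le_trans ?_ hdist
    nlinarith [sq_nonneg (x 0 * s - (x 1 - m * n) * c)]
  have hs2 : s ^ 2 * (1 + r ^ 2) ≤ r ^ 2 := by
    have h1 : s ^ 2 ≤ r ^ 2 * c ^ 2 := by
      rw [← sq_abs s, ← sq_abs c, ← mul_pow]
      exact pow_le_pow_left₀ (abs_nonneg _) hφ.le 2
    nlinarith
  -- The 4 comes from `m ≥ 1/2` and from `1 - s² ≤ 2(1 - |s|)`.
  have hd : (4 * (1 + r ^ 2))⁻¹ ≤ m * (1 - |s|) := by
    have hs1 : |s| ≤ 1 := Real.abs_sin_le_one φ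
    have h1 : (1 + r ^ 2)⁻¹ ≤ 1 - s ^ 2 := by
      rw [inv_le_iff_one_le_mul₀ (by positivity)]
      nlinarith
    have h2 : 1 - s ^ 2 ≤ 2 * (1 - |s|) := by
      rw [← sq_abs s]; nlinarith [abs_nonneg s]
    have h3 : (1 : ℝ) / 2 ≤ m := by rw [hm]; linarith
    rw [mul_inv]
    nlinarith
  rw [inner_dir]
  have hfin : |x 0 * c + x 1 * s| ≤ q * n + m * n * |s| := by
    have : x 0 * c + x 1 * s = (x 0 * c + (x 1 - m * n) * s) + (m * n) * s := by ring
    rw [this]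
    refine (abs_add_le _ _).trans (add_le_add hproj ?_)
    rw [abs_mul, abs_of_nonneg (mul_nonneg (by rw [hm]; linarith) hn.le)]
  refine hfin.trans ?_
  have hmq1 : q = 1 - m := by rw [hm, hq]; ring
  rw [hmq1]
  nlinarith

end Geometry

/-! ### The half-plane kernel and the signed transform. -/

section Kernel

/-- The kernel `sgn (p) 1_{s beyond p}`. -/
def kernel (p s : ℝ) : ℝ :=
  if 0 < p then (if p ≤ s then 1 else 0) else if p < 0 then (if s ≤ p then -1 else 0) else 0

theorem kernel_of_nonneg {s : ℝ} (hs : 0 ≤ s) (p : ℝ) :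
    kernel p s = (Set.Ioc 0 s).indicator 1 p := by
  simp only [kernel, Set.indicator_apply, Set.mem_Ioc, Pi.one_apply]
  split_ifs <;> first | rfl | (exfalso; grind)

theorem kernel_of_neg {s : ℝ} (hs : s < 0) (p : ℝ) :
    kernel p s = -(Set.Ico s 0).indicator 1 p := by
  simp only [kernel, Set.indicator_apply, Set.mem_Ico, Pi.one_apply]
  split_ifs <;> first | (exfalso; grind) | simp

theorem abs_kernel_le (p s : ℝ) : |kernel p s| ≤ 1 := by
  rw [kernel]; split_ifs <;> simp

theorem kernel_eq_zero {p s : ℝ} (h : |s| < |p|) : kernel p s = 0 := by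
  rw [kernel]
  split_ifs with h1 h2 h3 h4
  · rw [abs_of_pos h1] at h; linarith [le_abs_self s]
  · rfl
  · rw [abs_of_neg h3] at h; linarith [neg_abs_le s]
  · rfl
  · rfl

theorem measurable_kernel : Measurable fun z : ℝ × ℝ => kernel z.1 z.2 := by
  unfold kernel
  refine Measurable.ite (measurableSet_lt measurable_const measurable_fst) ?_ ?_
  · exact Measurable.ite (measurableSet_le measurable_fst measurable_snd) measurable_const
      measurable_const
  · refine Measurable.ite (measurableSet_lt measurable_fst measurable_const) ?_ measurable_const
    exact Measurable.ite (measurableSet_le measurable_snd measurable_fst) measurable_const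
      measurable_const

/-- As a function of `p`, the kernel is the oriented indicator of the interval between 0 and `s`;
its sign for `s < 0` matches that of the interval integral. -/
theorem integral_kernel_smul (s : ℝ) {F : ℝ → ℂ} :
    ∫ p, kernel p s • F p = ∫ p in (0 : ℝ)..s, F p := by
  rcases le_or_gt 0 s with h | h
  · rw [intervalIntegral.integral_of_le h, ← integral_indicator measurableSet_Ioc]
    refine integral_congr_ae (Eventually.of_forall fun p => ?_)
    simp only [kernel_of_nonneg h, Set.indicator_apply]
    split_ifs <;> simp
  · rw [intervalIntegral.integral_of_ge h.le, ← integral_Ico_eq_integral_Ioc,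
      ← integral_indicator measurableSet_Ico, ← integral_neg]
    refine integral_congr_ae (Eventually.of_forall fun p => ?_)
    simp only [kernel_of_neg h, Set.indicator_apply]
    split_ifs <;> simp

/-- The fundamental theorem of calculus on the interval from 0 to `s`. The value 1 at 0 produces the
mass term of the slice formula, and the derivative its factor `ρ`. -/
theorem exp_eq_one_sub_integral_kernel (ρ s : ℝ) :
    Complex.exp (-(2 * Real.pi * ρ * s : ℝ) * Complex.I) =
      1 - 2 * Real.pi * ρ * Complex.I *
        ∫ p, kernel p s • Complex.exp (-(2 * Real.pi * ρ * p : ℝ) * Complex.I) := by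
  rw [integral_kernel_smul]
  set a : ℂ := -(2 * Real.pi * ρ) * Complex.I with ha
  have hexp : ∀ p : ℝ, -((2 * Real.pi * ρ * p : ℝ) : ℂ) * Complex.I = a * p := by
    intro p; rw [ha]; push_cast; ring
  simp only [hexp]
  rcases eq_or_ne a 0 with h | h
  · have : 2 * Real.pi * ρ * Complex.I = 0 := by rw [← neg_eq_zero, ← h, ha]; ring
    rw [this, h]; simp
  · rw [integral_exp_mul_complex h]
    have : 2 * Real.pi * ρ * Complex.I = -a := by rw [ha]; ring
    rw [this]
    field_simp
    simp

/-- The unjumped transform `sgn (p) D2 f p φ`, written as an integral against the kernel. -/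
def signedTransform (f : Plane → ℝ) (p φ : ℝ) : ℝ := ∫ x, kernel p ⟪inv x, dir φ⟫ * f x

/-- For `p < 0`, turning the direction by `π` gives the opposite half-plane `⟪inv x, dir φ⟫ ≤ p`, so
multiplying by the sign joins both cases in one kernel. The hypothesis `h0` covers the origin, where
`inv 0 = 0` has no geometric meaning; at `p = 0` both sides vanish. -/
theorem sign_mul_D2 {f : Plane → ℝ} (h0 : f 0 = 0) (p φ : ℝ) :
    Real.sign p * D2 f p φ = signedTransform f p φ := by
  have hd : ∀ d φ, MeasurableSet (disc d φ) := fun d φ => Metric.isClosed_closedBall.measurableSet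
  rcases lt_trichotomy p 0 with hp | rfl | hp
  · rw [Real.sign_of_neg hp, D2, if_neg hp.not_gt, if_neg hp.ne, D1,
      ← integral_indicator (hd _ _), ← integral_const_mul, signedTransform]
    refine integral_congr_ae (Eventually.of_forall fun x => ?_)
    rcases eq_or_ne x 0 with rfl | hx
    · simp [h0]
    · have : x ∈ disc (1 / -p) (φ + Real.pi) ↔ ⟪inv x, dir φ⟫ ≤ p := by
        rw [mem_disc_iff (neg_pos.2 hp), ← le_inner_inv_dir_iff hx, dir_add_pi, inner_neg_right,
          neg_le_neg_iff]
      by_cases h : ⟪inv x, dir φ⟫ ≤ p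
      · dsimp only
        rw [Set.indicator_of_mem (this.2 h)]
        simp [kernel, hp.not_gt, hp, h]
      · dsimp only
        rw [Set.indicator_of_notMem (this.not.2 h)]
        simp [kernel, hp.not_gt, h]
  · simp [signedTransform, kernel]
  · rw [Real.sign_of_pos hp, D2, if_pos hp, D1, ← integral_indicator (hd _ _), one_mul,
      signedTransform]
    refine integral_congr_ae (Eventually.of_forall fun x => ?_)
    rcases eq_or_ne x 0 with rfl | hx
    · simp [h0]
    · have : x ∈ disc (1 / p) φ ↔ p ≤ ⟪inv x, dir φ⟫ := by
        rw [mem_disc_iff hp, ← le_inner_inv_dir_iff hx]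
      by_cases h : p ≤ ⟪inv x, dir φ⟫
      · dsimp only
        rw [Set.indicator_of_mem (this.2 h)]
        simp [kernel, hp, h]
      · dsimp only
        rw [Set.indicator_of_notMem (this.not.2 h)]
        simp [kernel, hp, h]

end Kernel

/-! ### The Fourier slice formula. -/

section Slice

/-- The function `y ↦ |y|⁻⁴ f (y / |y|²)`. -/
def pull (f : Plane → ℝ) (y : Plane) : ℂ := ((‖inv y‖ ^ 4 * f (inv y) : ℝ) : ℂ)

theorem measurable_inv : Measurable inv := by
  have : inv = fun x => (‖x‖ ^ 2)⁻¹ • x := funext inv_eq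
  rw [this]
  fun_prop

theorem continuous_dir : Continuous dir := by
  unfold dir
  fun_prop

/-- The weight in `pull` cancels the Jacobian of inversion, so `pull f` is the density of the image
of `f dx`. -/
theorem fourier_pull {f : Plane → ℝ} (h0 : f 0 = 0) (ξ : Plane) :
    𝓕 (pull f) ξ =
      ∫ x, Complex.exp (-(2 * Real.pi * ⟪inv x, ξ⟫ : ℝ) * Complex.I) * (f x : ℂ) := by
  rw [Real.fourier_eq', ← integral_comp_inv]
  refine integral_congr_ae (Eventually.of_forall fun x => ?_)
  rcases eq_or_ne x 0 with rfl | hx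
  · simp [h0]
  · have hn : ‖x‖ ≠ 0 := norm_ne_zero_iff.2 hx
    dsimp only
    rw [pull, inv_inv, smul_eq_mul, Complex.real_smul]
    have h1 : ((‖x‖⁻¹ ^ 4 : ℝ) : ℂ) * ((‖x‖ ^ 4 : ℝ) : ℂ) = 1 := by
      rw [← Complex.ofReal_mul, ← mul_pow, inv_mul_cancel₀ hn]; simp
    have h2 : ((-2 * Real.pi * ⟪inv x, ξ⟫ : ℝ) : ℂ) = -((2 * Real.pi * ⟪inv x, ξ⟫ : ℝ) : ℂ) := by
      push_cast; ring
    rw [h2, Complex.ofReal_mul (‖x‖ ^ 4)]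
    linear_combination (Complex.exp (-(2 * Real.pi * ⟪inv x, ξ⟫ : ℝ) * Complex.I) * f x) * h1

variable {r : ℝ} {f : Plane → ℝ}

theorem abs_inner_inv_dir_lt_one (hr : 1 < r) {x : Plane} (hx : x ∈ ringDisc r) (φ : ℝ) :
    |⟪inv x, dir φ⟫| < 1 :=
  (abs_inner_inv_dir_le x φ).trans_lt (inv_lt_one_of_one_lt₀ (one_lt_norm_of_mem_ringDisc hr hx))

theorem kernel_mul_eq_zero (hr : 1 < r) (hfr : ∀ x, x ∉ ringDisc r → f x = 0) {p : ℝ}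
    (hp : 1 ≤ |p|) (φ : ℝ) (x : Plane) : kernel p ⟪inv x, dir φ⟫ * f x = 0 := by
  by_cases hx : x ∈ ringDisc r
  · rw [kernel_eq_zero ((abs_inner_inv_dir_lt_one hr hx φ).trans_le hp), zero_mul]
  · rw [hfr x hx, mul_zero]

theorem signedTransform_eq_zero (hr : 1 < r) (hfr : ∀ x, x ∉ ringDisc r → f x = 0) {p : ℝ}
    (hp : 1 ≤ |p|) (φ : ℝ) : signedTransform f p φ = 0 := by
  simp [signedTransform, kernel_mul_eq_zero hr hfr hp φ]

/-- Expand the exponential by `exp_eq_one_sub_integral_kernel` under the integral against `f`, then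
exchange the `x` and `p` integrations. -/
theorem fourier_pull_dir (hr : 1 < r) (hf : Integrable f)
    (hfr : ∀ x, x ∉ ringDisc r → f x = 0) (ρ φ : ℝ) :
    𝓕 (pull f) (ρ • dir φ) = ((∫ x, f x : ℝ) : ℂ) - 2 * Real.pi * ρ * Complex.I *
      𝓕 (fun p : ℝ => (signedTransform f p φ : ℂ)) ρ := by
  have h0 : f 0 = 0 := hfr 0 fun h => ne_zero_of_mem_ringDisc hr h rfl
  set e : ℝ → ℂ := fun p => Complex.exp (-(2 * Real.pi * ρ * p : ℝ) * Complex.I) with he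
  have hec : Continuous e := by rw [he]; fun_prop
  have hen : ∀ p, ‖e p‖ = 1 := fun p => by
    rw [he]; dsimp only; rw [← Complex.ofReal_neg, Complex.norm_exp_ofReal_mul_I]
  have hint : Integrable (Function.uncurry fun (x : Plane) (p : ℝ) =>
      (kernel p ⟪inv x, dir φ⟫ • e p) * (f x : ℂ)) (volume.prod volume) := by
    -- The support disc lies outside the unit disc, so its inverse lies inside and the kernel is cut
    -- off at `|p| < 1`; this makes the `p`-integration absolutely convergent.
    have hdom : Integrable (fun z : Plane × ℝ => ‖f z.1‖ * (Set.Icc (-1 : ℝ) 1).indicator 1 z.2)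
        (volume.prod volume) :=
      hf.norm.mul_prod ((integrable_indicator_iff measurableSet_Icc).2
        (integrableOn_const (by simp)))
    refine hdom.mono' ?_ (Eventually.of_forall fun z => ?_)
    · have hk : Measurable fun z : Plane × ℝ => kernel z.2 ⟪inv z.1, dir φ⟫ :=
        measurable_kernel.comp (measurable_snd.prodMk
          ((measurable_inv.comp measurable_fst).inner measurable_const))
      refine AEStronglyMeasurable.mul ?_ ?_
      · exact (hk.smul (hec.measurable.comp measurable_snd)).aestronglyMeasurable
      · exact Complex.continuous_ofReal.comp_aestronglyMeasurable hf.aestronglyMeasurable.comp_fst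
    · simp only [Function.uncurry, norm_mul, norm_smul, hen, Complex.norm_real, mul_one]
      by_cases hp : z.2 ∈ Set.Icc (-1 : ℝ) 1
      · rw [Set.indicator_of_mem hp, Pi.one_apply, mul_one]
        exact mul_le_of_le_one_left (norm_nonneg _) (abs_kernel_le _ _)
      · have : 1 ≤ |z.2| := by
          by_contra! h
          exact hp (abs_le.1 h.le)
        rw [← norm_mul, kernel_mul_eq_zero hr hfr this]
        rw [norm_zero]
        exact mul_nonneg (norm_nonneg _) (Set.indicator_nonneg (fun _ _ => zero_le_one) _)
  have hpt : ∀ x, Complex.exp (-(2 * Real.pi * ⟪inv x, ρ • dir φ⟫ : ℝ) * Complex.I) * (f x : ℂ) =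
      f x - 2 * Real.pi * ρ * Complex.I * ∫ p, (kernel p ⟪inv x, dir φ⟫ • e p) * (f x : ℂ) := by
    intro x
    rw [inner_smul_right, ← mul_assoc, exp_eq_one_sub_integral_kernel, integral_mul_const]
    ring
  rw [fourier_pull h0]
  simp only [hpt]
  have hint2 := hint.integral_prod_left
  simp only [Function.uncurry] at hint2
  have hfc : Integrable fun x => (f x : ℂ) := hf.ofReal
  rw [integral_sub hfc (hint2.const_mul (2 * Real.pi * ρ * Complex.I)), integral_const_mul, integral_integral_swap hint,
    integral_complex_ofReal, Real.fourier_real_eq_integral_exp_smul]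
  congr 2
  refine integral_congr_ae (Eventually.of_forall fun p => ?_)
  dsimp only
  have : ∀ x, (kernel p ⟪inv x, dir φ⟫ • e p) * (f x : ℂ) =
      e p * ((kernel p ⟪inv x, dir φ⟫ * f x : ℝ) : ℂ) := by
    intro x
    rw [Complex.real_smul]; push_cast; ring
  simp only [this]
  rw [integral_const_mul, integral_complex_ofReal, signedTransform, smul_eq_mul]
  congr 1
  rw [he]
  dsimp only
  congr 2
  push_cast
  ring

end Slice

/-! ### Measurability and slicing of the disc transform by direction. -/

section Measurability

variable {r : ℝ} {f : Plane → ℝ}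

theorem measurable_signedTransform (hf : Measurable f) :
    Measurable fun z : ℝ × ℝ => signedTransform f z.1 z.2 := by
  have : Measurable fun w : (ℝ × ℝ) × Plane => kernel w.1.1 ⟪inv w.2, dir w.1.2⟫ * f w.2 := by
    refine Measurable.mul ?_ (hf.comp measurable_snd)
    have hs : Measurable fun w : (ℝ × ℝ) × Plane => ⟪inv w.2, dir w.1.2⟫ :=
      (measurable_inv.comp measurable_snd).inner
        (continuous_dir.measurable.comp (measurable_snd.comp measurable_fst))
    exact measurable_kernel.comp ((measurable_fst.comp measurable_fst).prodMk hs)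
  exact this.stronglyMeasurable.integral_prod_right'.measurable

theorem measurable_D1zero (hf : Measurable f) (hfi : Integrable f) : Measurable (D1zero f) := by
  have hm : MeasurableSet {w : ℝ × Plane | 0 < ⟪w.2, dir w.1⟫} :=
    measurableSet_lt measurable_const
      (measurable_snd.inner (continuous_dir.measurable.comp measurable_fst))
  have h1 : Measurable (Set.indicator {w : ℝ × Plane | 0 < ⟪w.2, dir w.1⟫} fun w => f w.2) :=
    (hf.comp measurable_snd).indicator hm
  have h2 : D1zero f = fun φ => ∫ x, Set.indicator {w : ℝ × Plane | 0 < ⟪w.2, dir w.1⟫}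
      (fun w => f w.2) (φ, x) := by
    ext φ
    have hms : MeasurableSet {x : Plane | 0 < ⟪x, dir φ⟫} :=
      measurableSet_lt measurable_const (measurable_id.inner measurable_const)
    rw [D1zero_eq hfi, ← integral_indicator hms]
    rfl
  rw [h2]
  exact h1.stronglyMeasurable.integral_prod_right'.measurable

theorem measurable_jump (hf : Measurable f) (hfi : Integrable f) : Measurable (jump f) := by
  unfold jump
  have := measurable_D1zero hf hfi
  fun_prop

/-- The sign squares to 1 off `p = 0`. Up to a factor `±1`, the data are the signed transform plus a
term constant in `p`. -/
theorem discTransform_eq_sign_mul (h0 : f 0 = 0) {z : ℝ × ℝ} (hz : z.1 ≠ 0) :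
    discTransform f z = Real.sign z.1 * (signedTransform f z.1 z.2 + jump f z.2) := by
  rw [discTransform, mul_add, ← sign_mul_D2 h0, ← mul_assoc]
  have : Real.sign z.1 * Real.sign z.1 = 1 := by
    rcases Real.sign_apply_eq_of_ne_zero z.1 hz with h | h <;> rw [h] <;> norm_num
  rw [this]
  ring

theorem ae_fst_ne_zero : ∀ᵐ z : ℝ × ℝ, z.1 ≠ 0 := by
  have h : ∀ᵐ p : ℝ, p ≠ 0 := by simp [ae_iff]
  exact Measure.quasiMeasurePreserving_fst.ae h

theorem aemeasurable_discTransform (hf : Measurable f) (hfi : Integrable f) (h0 : f 0 = 0) :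
    AEMeasurable (discTransform f) := by
  refine ⟨fun z => Real.sign z.1 * (signedTransform f z.1 z.2 + jump f z.2), ?_, ?_⟩
  · have h1 : Measurable fun z : ℝ × ℝ => Real.sign z.1 := by
      unfold Real.sign
      exact Measurable.ite (measurableSet_lt measurable_fst measurable_const) measurable_const
        (Measurable.ite (measurableSet_lt measurable_const measurable_fst) measurable_const
          measurable_const)
    exact h1.mul ((measurable_signedTransform hf).add
      ((measurable_jump hf hfi).comp measurable_snd))
  · filter_upwards [ae_fst_ne_zero] with z hz using discTransform_eq_sign_mul h0 hz

theorem cylMeasure_eq_prod : cylMeasure =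
    (volume.restrict (Set.Icc (-1 : ℝ) 1)).prod
      (volume.restrict (Set.Ico (0 : ℝ) (2 * Real.pi))) := by
  rw [cylMeasure, Measure.volume_eq_prod, Measure.prod_restrict]

/-- The squared norm of the disc transform on the circle of angle `φ`. -/
def sliceEnergy (f : Plane → ℝ) (φ : ℝ) : ℝ≥0∞ :=
  ∫⁻ p in Set.Icc (-1 : ℝ) 1, ENNReal.ofReal (‖signedTransform f p φ + jump f φ‖ ^ 2)

theorem energy_discTransform (hf : Measurable f) (hfi : Integrable f) (h0 : f 0 = 0) :
    energy cylMeasure (discTransform f) =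
      ∫⁻ φ in Set.Ico 0 (2 * Real.pi), sliceEnergy f φ := by
  have hm : Measurable fun z : ℝ × ℝ =>
      ENNReal.ofReal (‖signedTransform f z.1 z.2 + jump f z.2‖ ^ 2) :=
    ((((measurable_signedTransform hf).add
      ((measurable_jump hf hfi).comp measurable_snd)).norm).pow_const 2).ennreal_ofReal
  have h1 : energy cylMeasure (discTransform f) = ∫⁻ z, ENNReal.ofReal
      (‖signedTransform f z.1 z.2 + jump f z.2‖ ^ 2) ∂cylMeasure := by
    refine lintegral_congr_ae ?_
    filter_upwards [ae_restrict_of_ae ae_fst_ne_zero] with z hz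
    rw [discTransform_eq_sign_mul h0 hz, norm_mul]
    rcases Real.sign_apply_eq_of_ne_zero z.1 hz with h | h <;> rw [h] <;> simp
  rw [h1, cylMeasure_eq_prod, lintegral_prod_symm _ hm.aemeasurable]
  rfl

end Measurability

/-! ### Recovering the jump and the mass from the data. -/

section Gap

variable {r : ℝ} {f : Plane → ℝ}

/-- The signed transform vanishes on an interval of `p` whose length is bounded below. -/
theorem exists_gap (hr : 1 < r) (hfr : ∀ x, x ∉ ringDisc r → f x = 0) (φ : ℝ) :
    ∃ a b : ℝ, Set.Ioo a b ⊆ Set.Icc (-1) 1 ∧ (4 * (1 + r ^ 2))⁻¹ ≤ b - a ∧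
      ∀ p ∈ Set.Ioo a b, signedTransform f p φ = 0 := by
  have hδ : (4 * (1 + r ^ 2))⁻¹ ≤ 1 := inv_le_one_of_one_le₀ (by nlinarith)
  have hδ0 : 0 < (4 * (1 + r ^ 2))⁻¹ := by positivity
  have red : ∀ p, (∀ x ∈ ringDisc r, kernel p ⟪inv x, dir φ⟫ = 0) →
      signedTransform f p φ = 0 := by
    intro p h
    rw [signedTransform]
    refine integral_eq_zero_of_ae (Eventually.of_forall fun x => ?_)
    by_cases hx : x ∈ ringDisc r
    · simp [h x hx]
    · simp [hfr x hx]
  -- Away from the vertical, the inverted support projects strictly inside `[-1, 1]`, leaving a gap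
  -- below `p = 1`. Near the vertical, it lies on one side of 0, and the whole half-interval on the
  -- other side is a gap.
  rcases lt_or_ge |Real.sin φ| (r * |Real.cos φ|) with h | h
  · refine ⟨1 - (4 * (1 + r ^ 2))⁻¹, 1, ?_, by linarith, fun p hp => red p fun x hx => ?_⟩
    · exact Set.Ioo_subset_Icc_self.trans (Set.Icc_subset_Icc (by linarith) le_rfl)
    · refine kernel_eq_zero ((abs_inner_inv_dir_le_of_mem_ringDisc hr hx h).trans_lt ?_)
      exact hp.1.trans_le (le_abs_self p)
  · rcases le_or_gt 0 (Real.sin φ) with hs | hs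
    · rw [abs_of_nonneg hs] at h
      refine ⟨-1, 0, ?_, by linarith, fun p hp => red p fun x hx => ?_⟩
      · exact Set.Ioo_subset_Icc_self.trans (Set.Icc_subset_Icc le_rfl zero_le_one)
      · have hx0 := ne_zero_of_mem_ringDisc hr hx
        have hpos : 0 < ⟪inv x, dir φ⟫ := by
          rw [inner_inv_dir]
          exact mul_pos (by positivity) (inner_dir_pos_of_mem_ringDisc hr hx h)
        rw [kernel, if_neg hp.2.not_gt, if_pos hp.2, if_neg (hp.2.trans hpos).not_ge]
    · rw [abs_of_neg hs] at h
      refine ⟨0, 1, ?_, by linarith, fun p hp => red p fun x hx => ?_⟩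
      · exact Set.Ioo_subset_Icc_self.trans (Set.Icc_subset_Icc (by norm_num) le_rfl)
      · have hx0 := ne_zero_of_mem_ringDisc hr hx
        have hneg : ⟪inv x, dir φ⟫ < 0 := by
          have h1 := inner_dir_pos_of_mem_ringDisc hr hx (φ := φ + Real.pi)
            (by simpa [Real.cos_add_pi, Real.sin_add_pi] using h)
          rw [dir_add_pi, inner_neg_right] at h1
          rw [inner_inv_dir]
          exact mul_neg_of_pos_of_neg (by positivity) (by linarith)
        rw [kernel, if_pos hp.1, if_neg (hneg.trans hp.1).not_ge]

/-- On the gap the integrand of the slice energy is the constant `‖jump f φ‖²`. -/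
theorem jump_sq_le_sliceEnergy (hr : 1 < r) (hfr : ∀ x, x ∉ ringDisc r → f x = 0) (φ : ℝ) :
    ENNReal.ofReal (‖jump f φ‖ ^ 2) * ENNReal.ofReal (4 * (1 + r ^ 2))⁻¹ ≤ sliceEnergy f φ := by
  obtain ⟨a, b, hab, hlen, hgap⟩ := exists_gap hr hfr φ
  calc ENNReal.ofReal (‖jump f φ‖ ^ 2) * ENNReal.ofReal (4 * (1 + r ^ 2))⁻¹
      ≤ ENNReal.ofReal (‖jump f φ‖ ^ 2) * volume (Set.Ioo a b) := by
        rw [Real.volume_Ioo]; gcongr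
    _ = ∫⁻ p in Set.Ioo a b, ENNReal.ofReal (‖signedTransform f p φ + jump f φ‖ ^ 2) := by
        rw [← setLIntegral_const]
        refine setLIntegral_congr_fun measurableSet_Ioo fun p hp => ?_
        rw [hgap p hp, zero_add]
    _ ≤ sliceEnergy f φ := lintegral_mono_set hab

/-- One of the two opposite half-planes contains the support of `f` and the other misses it. -/
theorem jump_eq_of_le_sin (hr : 1 < r) (hfi : Integrable f)
    (hfr : ∀ x, x ∉ ringDisc r → f x = 0) {φ : ℝ} (hφ : r * |Real.cos φ| ≤ Real.sin φ) :
    jump f φ = -(∫ x, f x) / 2 := by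
  have h1 : D1zero f φ = ∫ x, f x := by
    rw [D1zero_eq hfi]
    refine setIntegral_eq_integral_of_forall_compl_eq_zero fun x hx => hfr x fun h => hx ?_
    exact inner_dir_pos_of_mem_ringDisc hr h hφ
  have h2 : D1zero f (φ + Real.pi) = 0 := by
    rw [D1zero_eq hfi]
    refine setIntegral_eq_zero_of_forall_eq_zero fun x hx => hfr x fun h => ?_
    have h3 : 0 < ⟪x, dir (φ + Real.pi)⟫ := hx
    rw [dir_add_pi, inner_neg_right] at h3
    linarith [inner_dir_pos_of_mem_ringDisc hr h hφ]
  rw [jump, h1, h2, zero_sub]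

/-- The total mass is controlled by the disc transform. -/
theorem exists_mass_le (hr : 1 < r) : ∃ C : ℝ≥0∞, C ≠ ⊤ ∧ ∀ f : Plane → ℝ, Integrable f →
    (∀ x, x ∉ ringDisc r → f x = 0) →
      ENNReal.ofReal (‖∫ x, f x‖ ^ 2) ≤ C * ∫⁻ φ in Set.Ico 0 (2 * Real.pi), sliceEnergy f φ := by
  -- An open set of nearly vertical directions, nonempty because it contains `π/2`; averaging over
  -- it turns the pointwise jump bound into a bound by the full energy.
  set S : Set ℝ := Set.Ioo 0 (2 * Real.pi) ∩ {φ | r * |Real.cos φ| < Real.sin φ} with hS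
  have hSo : IsOpen S := isOpen_Ioo.inter
    (isOpen_lt (by fun_prop) Real.continuous_sin)
  have hSn : S.Nonempty := by
    refine ⟨Real.pi / 2, ⟨?_, ?_⟩, ?_⟩
    · linarith [Real.pi_pos]
    · linarith [Real.pi_pos]
    · simp
  have hSsub : S ⊆ Set.Ico 0 (2 * Real.pi) := fun φ hφ => ⟨hφ.1.1.le, hφ.1.2⟩
  have hv0 : volume S ≠ 0 := (hSo.measure_pos volume hSn).ne'
  have hvt : volume S ≠ ⊤ :=
    ((measure_mono hSsub).trans_lt (by rw [Real.volume_Ico]; exact ENNReal.ofReal_lt_top)).ne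
  set δ : ℝ := (4 * (1 + r ^ 2))⁻¹ with hδ
  have hδ0 : 0 < δ := by positivity
  have hδE : ENNReal.ofReal δ ≠ 0 := by simpa using hδ0
  have hK0 : ENNReal.ofReal δ * volume S ≠ 0 := mul_ne_zero hδE hv0
  have hKt : ENNReal.ofReal δ * volume S ≠ ⊤ := ENNReal.mul_ne_top ENNReal.ofReal_ne_top hvt
  refine ⟨4 * (ENNReal.ofReal δ * volume S)⁻¹, ENNReal.mul_ne_top (by norm_num)
    (ENNReal.inv_ne_top.2 hK0), fun f hfi hfr => ?_⟩
  have hmain : ENNReal.ofReal (‖∫ x, f x‖ ^ 2) * (ENNReal.ofReal δ * volume S) ≤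
      4 * ∫⁻ φ in Set.Ico 0 (2 * Real.pi), sliceEnergy f φ := by
    calc _ = ∫⁻ _ in S, ENNReal.ofReal (‖∫ x, f x‖ ^ 2) * ENNReal.ofReal δ := by
          rw [setLIntegral_const, mul_assoc]
      _ ≤ ∫⁻ φ in S, 4 * sliceEnergy f φ := by
          refine setLIntegral_mono' hSo.measurableSet fun φ hφ => ?_
          have hj := jump_eq_of_le_sin hr hfi hfr (le_of_lt hφ.2)
          have h4 : ENNReal.ofReal (‖∫ x, f x‖ ^ 2) = 4 * ENNReal.ofReal (‖jump f φ‖ ^ 2) := by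
            rw [show (4 : ℝ≥0∞) = ENNReal.ofReal 4 by simp, ← ENNReal.ofReal_mul (by norm_num), hj,
              norm_div, norm_neg]
            congr 1
            rw [Real.norm_ofNat]
            ring
          rw [h4, mul_assoc]
          gcongr
          exact jump_sq_le_sliceEnergy hr hfr φ
      _ ≤ ∫⁻ φ in Set.Ico 0 (2 * Real.pi), 4 * sliceEnergy f φ := lintegral_mono_set hSsub
      _ = _ := lintegral_const_mul' _ _ (by norm_num)
  rw [mul_comm 4, mul_assoc, mul_comm, ← div_eq_mul_inv, ENNReal.le_div_iff_mul_le (.inl hK0)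
    (.inl hKt)]
  exact hmain

theorem measurable_signedTransform_left (hf : Measurable f) (φ : ℝ) :
    Measurable fun p => signedTransform f p φ :=
  (measurable_signedTransform hf).comp (measurable_id.prodMk measurable_const)

/-- Write the signed transform as data minus jump on `[-1, 1]`; it vanishes elsewhere. The 4 is the
2 of `energy_add_le` times the length of the interval. -/
theorem energy_signedTransform_le (hr : 1 < r) (hf : Measurable f)
    (hfr : ∀ x, x ∉ ringDisc r → f x = 0) (φ : ℝ) :
    energy volume (fun p => (signedTransform f p φ : ℂ)) ≤
      (2 + 4 * (ENNReal.ofReal (4 * (1 + r ^ 2))⁻¹)⁻¹) * sliceEnergy f φ := by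
  have hδ0 : 0 < (4 * (1 + r ^ 2))⁻¹ := by positivity
  have h1 : energy volume (fun p => (signedTransform f p φ : ℂ)) =
      energy (volume.restrict (Set.Icc (-1 : ℝ) 1)) fun p =>
        (signedTransform f p φ + jump f φ) + -jump f φ := by
    rw [energy, energy, ← lintegral_indicator measurableSet_Icc]
    refine lintegral_congr fun p => ?_
    by_cases hp : p ∈ Set.Icc (-1 : ℝ) 1
    · rw [Set.indicator_of_mem hp, Complex.norm_real, add_neg_cancel_right]
    · rw [Set.indicator_of_notMem hp, signedTransform_eq_zero hr hfr]
      · simp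
      · by_contra! h
        exact hp (abs_le.1 h.le)
  rw [h1]
  refine (energy_add_le _ _ ((measurable_signedTransform_left hf φ).add_const
    _).aestronglyMeasurable).trans ?_
  rw [add_mul]
  refine add_le_add le_rfl ?_
  have h2 : energy (volume.restrict (Set.Icc (-1 : ℝ) 1)) (fun _ => -jump f φ) =
      2 * ENNReal.ofReal (‖jump f φ‖ ^ 2) := by
    rw [energy, setLIntegral_const, Real.volume_Icc, norm_neg, mul_comm]
    norm_num
  rw [h2, ← mul_assoc, mul_assoc 4]
  gcongr
  · norm_num
  · rw [mul_comm, ← div_eq_mul_inv, ENNReal.le_div_iff_mul_le (.inl (by simpa using hδ0))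
      (.inl ENNReal.ofReal_ne_top)]
    exact jump_sq_le_sliceEnergy hr hfr φ

end Gap

/-! ### Low frequencies in polar coordinates. -/

section LowFrequency

variable {r : ℝ} {f : Plane → ℝ}

theorem memLp_signedTransform (hr : 1 < r) (hf : Measurable f) (hfi : Integrable f)
    (hfr : ∀ x, x ∉ ringDisc r → f x = 0) (φ : ℝ) (q : ℝ≥0∞) :
    MemLp (fun p => (signedTransform f p φ : ℂ)) q := by
  have hm : Measurable fun p => (signedTransform f p φ : ℂ) :=
    Complex.measurable_ofReal.comp (measurable_signedTransform_left hf φ)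
  have h1 : (fun p => (signedTransform f p φ : ℂ)) =
      (Set.Icc (-1 : ℝ) 1).indicator fun p => (signedTransform f p φ : ℂ) := by
    ext p
    by_cases hp : p ∈ Set.Icc (-1 : ℝ) 1
    · rw [Set.indicator_of_mem hp]
    · rw [Set.indicator_of_notMem hp, signedTransform_eq_zero hr hfr, Complex.ofReal_zero]
      by_contra! h
      exact hp (abs_le.1 h.le)
  rw [h1, memLp_indicator_iff_restrict measurableSet_Icc]
  refine MemLp.of_bound hm.aestronglyMeasurable (∫ x, ‖f x‖) (Eventually.of_forall fun p => ?_)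
  rw [Complex.norm_real, signedTransform]
  refine norm_integral_le_of_norm_le hfi.norm (Eventually.of_forall fun x => ?_)
  rw [norm_mul]
  exact mul_le_of_le_one_left (norm_nonneg _) (abs_kernel_le _ _)

theorem norm_sq_fourier_pull_le (hr : 1 < r) (hfi : Integrable f)
    (hfr : ∀ x, x ∉ ringDisc r → f x = 0) (ρ φ : ℝ) :
    ‖𝓕 (pull f) (ρ • dir φ)‖ ^ 2 ≤ 2 * ‖∫ x, f x‖ ^ 2 +
      8 * Real.pi ^ 2 * ρ ^ 2 * ‖𝓕 (fun p : ℝ => (signedTransform f p φ : ℂ)) ρ‖ ^ 2 := by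
  rw [fourier_pull_dir hr hfi hfr]
  have h1 := norm_sub_le ((∫ x, f x : ℝ) : ℂ) (2 * Real.pi * ρ * Complex.I *
      𝓕 (fun p : ℝ => (signedTransform f p φ : ℂ)) ρ)
  have h2 : ‖2 * Real.pi * ρ * Complex.I * 𝓕 (fun p : ℝ => (signedTransform f p φ : ℂ)) ρ‖ =
      2 * Real.pi * |ρ| * ‖𝓕 (fun p : ℝ => (signedTransform f p φ : ℂ)) ρ‖ := by
    simp [abs_of_pos Real.pi_pos]
  rw [h2, Complex.norm_real] at h1
  set A := ‖∫ x, f x‖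
  set B := ‖𝓕 (fun p : ℝ => (signedTransform f p φ : ℂ)) ρ‖
  calc _ ≤ (A + 2 * Real.pi * |ρ| * B) ^ 2 := pow_le_pow_left₀ (norm_nonneg _) h1 2
    _ ≤ 2 * A ^ 2 + 2 * (2 * Real.pi * |ρ| * B) ^ 2 := by
        nlinarith [sq_nonneg (A - 2 * Real.pi * |ρ| * B)]
    _ = _ := by rw [mul_pow, mul_pow, sq_abs]; ring

/-- The polar weight `ρ` times the `ρ²` of the slice formula is at most `R³`, the source of the
exponent `3/2`; the remaining integral is handled by Plancherel in one variable. -/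
theorem lintegral_ray_le (hr : 1 < r) (hf : Measurable f) (hfi : Integrable f)
    (hfr : ∀ x, x ∉ ringDisc r → f x = 0) {R : ℝ} (hR : 1 ≤ R) (φ : ℝ) :
    ∫⁻ ρ in Set.Ioc 0 R, ENNReal.ofReal ρ * ENNReal.ofReal (‖𝓕 (pull f) (ρ • dir φ)‖ ^ 2) ≤
      ENNReal.ofReal (R ^ 3) * (2 * ENNReal.ofReal (‖∫ x, f x‖ ^ 2) +
        ENNReal.ofReal (8 * Real.pi ^ 2) * energy volume fun p => (signedTransform f p φ : ℂ)) := by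
  have hR0 : 0 < R := by linarith
  have hmem := memLp_signedTransform hr hf hfi hfr φ
  rw [← energy_fourier (memLp_one_iff_integrable.1 (hmem 1)) (hmem 2)]
  set B : ℝ → ℂ := 𝓕 fun p : ℝ => (signedTransform f p φ : ℂ) with hB
  set A := ‖∫ x, f x‖
  calc _ ≤ ∫⁻ ρ in Set.Ioc 0 R, (ENNReal.ofReal (R * (2 * A ^ 2)) +
        ENNReal.ofReal (R ^ 3 * (8 * Real.pi ^ 2)) * ENNReal.ofReal (‖B ρ‖ ^ 2)) := by
        refine setLIntegral_mono' measurableSet_Ioc fun ρ hρ => ?_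
        have h0 : 0 ≤ ρ := hρ.1.le
        rw [← ENNReal.ofReal_mul h0, ← ENNReal.ofReal_mul (by positivity),
          ← ENNReal.ofReal_add (by positivity) (by positivity)]
        refine ENNReal.ofReal_le_ofReal ?_
        calc ρ * ‖𝓕 (pull f) (ρ • dir φ)‖ ^ 2
            ≤ ρ * (2 * A ^ 2 + 8 * Real.pi ^ 2 * ρ ^ 2 * ‖B ρ‖ ^ 2) := by
              gcongr; exact norm_sq_fourier_pull_le hr hfi hfr ρ φ
          _ = ρ * (2 * A ^ 2) + ρ ^ 3 * (8 * Real.pi ^ 2) * ‖B ρ‖ ^ 2 := by ring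
          _ ≤ _ := by
              have := hρ.2
              gcongr
    _ ≤ ENNReal.ofReal (R * (2 * A ^ 2)) * ENNReal.ofReal R +
        ENNReal.ofReal (R ^ 3 * (8 * Real.pi ^ 2)) * energy volume B := by
        rw [lintegral_add_left measurable_const, setLIntegral_const, Real.volume_Ioc, sub_zero,
          lintegral_const_mul' _ _ ENNReal.ofReal_ne_top]
        gcongr
        exact setLIntegral_le_lintegral _ _
    _ ≤ _ := by
        rw [mul_add, ← mul_assoc (ENNReal.ofReal (R ^ 3)) (ENNReal.ofReal (8 * Real.pi ^ 2)),
          ← ENNReal.ofReal_mul (by positivity), ← ENNReal.ofReal_mul (by positivity)]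
        refine add_le_add ?_ le_rfl
        rw [show (2 : ℝ≥0∞) = ENNReal.ofReal 2 by simp, ← ENNReal.ofReal_mul (by norm_num),
          ← ENNReal.ofReal_mul (by positivity)]
        refine ENNReal.ofReal_le_ofReal ?_
        -- The mass term grows only like `R²`; `R ≥ 1` lets it share the factor `R³`.
        have h1 : R ^ 2 ≤ R ^ 3 := pow_le_pow_right₀ hR (by norm_num)
        nlinarith [mul_le_mul_of_nonneg_right h1 (by positivity : 0 ≤ 2 * A ^ 2)]

/-- Reconciles the angle range `(-π, π)` of `polarCoord` with the range `[0, 2π)` of `cylMeasure`.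
-/
theorem lintegral_Ioo_eq_lintegral_Ico_of_periodic {G : ℝ → ℝ≥0∞}
    (hG : Function.Periodic G (2 * Real.pi)) :
    ∫⁻ φ in Set.Ioo (-Real.pi) Real.pi, G φ = ∫⁻ φ in Set.Ico 0 (2 * Real.pi), G φ := by
  rw [setLIntegral_congr Ioo_ae_eq_Ioc, setLIntegral_congr Ico_ae_eq_Ioc]
  have : VAddInvariantMeasure (AddSubgroup.zmultiples (2 * Real.pi)) ℝ volume :=
    ⟨fun c s _ => measure_preimage_add _ _ _⟩
  have h1 := isAddFundamentalDomain_Ioc Real.two_pi_pos (-Real.pi)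
  have h2 := isAddFundamentalDomain_Ioc Real.two_pi_pos 0
  rw [show -Real.pi + 2 * Real.pi = Real.pi by ring] at h1
  rw [zero_add] at h2
  exact h1.setLIntegral_eq h2 G hG.map_vadd_zmultiples

/-- Integration in polar coordinates on the Euclidean plane. -/
theorem lintegral_polar {F : Plane → ℝ≥0∞} (hF : Measurable F) :
    ∫⁻ η, F η = ∫⁻ φ in Set.Ico 0 (2 * Real.pi), ∫⁻ ρ in Set.Ioi (0 : ℝ),
      ENNReal.ofReal ρ * F (ρ • dir φ) := by
  have hpres : MeasurePreserving (fun z : ℝ × ℝ => (!₂[z.1, z.2] : Plane)) := by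
    have h := (PiLp.volume_preserving_toLp (Fin 2)).comp (volume_preserving_finTwoArrow ℝ).symm
    exact h
  have hm : Measurable fun z : ℝ × ℝ => ENNReal.ofReal z.1 * F (z.1 • dir z.2) := by
    refine (ENNReal.measurable_ofReal.comp measurable_fst).mul (hF.comp ?_)
    exact measurable_fst.smul (continuous_dir.measurable.comp measurable_snd)
  rw [← hpres.lintegral_comp hF, ← lintegral_comp_polarCoord_symm]
  rw [← lintegral_Ioo_eq_lintegral_Ico_of_periodic]
  · rw [polarCoord_target, Measure.volume_eq_prod, ← Measure.prod_restrict,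
      ← lintegral_prod_symm _ hm.aemeasurable]
    refine lintegral_congr fun z => ?_
    rw [smul_eq_mul, polarCoord_symm_apply]
    congr 2
    ext i
    fin_cases i <;> simp [dir]
  · intro φ
    have : dir (φ + 2 * Real.pi) = dir φ := by simp [dir]
    simp only [this]

/-- Low frequencies are controlled by the disc transform. -/
theorem exists_low_frequency_le (hr : 1 < r) : ∃ C : ℝ≥0∞, C ≠ ⊤ ∧ ∀ f : Plane → ℝ,
    Measurable f → Integrable f → (∀ x, x ∉ ringDisc r → f x = 0) → Continuous (𝓕 (pull f)) →
      ∀ R : ℝ, 1 ≤ R → ∫⁻ η in {η : Plane | ‖η‖ ≤ R}, ENNReal.ofReal (‖𝓕 (pull f) η‖ ^ 2) ≤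
        C * ENNReal.ofReal (R ^ 3) * energy cylMeasure (discTransform f) := by
  obtain ⟨C₁, hC₁, hmass⟩ := exists_mass_le hr
  have hδ0 : 0 < (4 * (1 + r ^ 2))⁻¹ := by positivity
  set C₂ : ℝ≥0∞ := 2 + 4 * (ENNReal.ofReal (4 * (1 + r ^ 2))⁻¹)⁻¹ with hC₂
  have hC₂t : C₂ ≠ ⊤ := by
    rw [hC₂]
    refine ENNReal.add_ne_top.2 ⟨by norm_num, ENNReal.mul_ne_top (by norm_num) ?_⟩
    exact ENNReal.inv_ne_top.2 (by simpa using hδ0)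
  refine ⟨2 * C₁ * ENNReal.ofReal (2 * Real.pi) + ENNReal.ofReal (8 * Real.pi ^ 2) * C₂, ?_, ?_⟩
  · refine ENNReal.add_ne_top.2 ⟨?_, ENNReal.mul_ne_top ENNReal.ofReal_ne_top hC₂t⟩
    exact ENNReal.mul_ne_top (ENNReal.mul_ne_top (by norm_num) hC₁) ENNReal.ofReal_ne_top
  intro f hf hfi hfr hcont R hR
  have h0 : f 0 = 0 := hfr 0 fun h => ne_zero_of_mem_ringDisc hr h rfl
  have hball : MeasurableSet {η : Plane | ‖η‖ ≤ R} :=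
    (isClosed_le continuous_norm continuous_const).measurableSet
  have hmF : Measurable ({η : Plane | ‖η‖ ≤ R}.indicator fun η =>
      ENNReal.ofReal (‖𝓕 (pull f) η‖ ^ 2)) :=
    (hcont.norm.pow 2).measurable.ennreal_ofReal.indicator hball
  rw [← lintegral_indicator hball, lintegral_polar hmF, energy_discTransform hf hfi h0]
  set E := ∫⁻ φ in Set.Ico 0 (2 * Real.pi), sliceEnergy f φ
  have hray : ∀ φ, ∫⁻ ρ in Set.Ioi (0 : ℝ), ENNReal.ofReal ρ *
      ({η : Plane | ‖η‖ ≤ R}.indicator fun η => ENNReal.ofReal (‖𝓕 (pull f) η‖ ^ 2))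
        (ρ • dir φ) ≤ ENNReal.ofReal (R ^ 3) * (2 * (C₁ * E) +
        ENNReal.ofReal (8 * Real.pi ^ 2) * (C₂ * sliceEnergy f φ)) := by
    intro φ
    calc _ = ∫⁻ ρ in Set.Ioc 0 R,
          ENNReal.ofReal ρ * ENNReal.ofReal (‖𝓕 (pull f) (ρ • dir φ)‖ ^ 2) := by
          rw [← lintegral_indicator measurableSet_Ioi, ← lintegral_indicator measurableSet_Ioc]
          refine lintegral_congr fun ρ => ?_
          by_cases h1 : ρ ∈ Set.Ioi (0 : ℝ)
          · have hn : ‖ρ • dir φ‖ = ρ := by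
              rw [norm_smul, norm_dir, mul_one, Real.norm_of_nonneg (le_of_lt h1)]
            rw [Set.indicator_of_mem h1]
            by_cases h2 : ρ ≤ R
            · rw [Set.indicator_of_mem (show ρ • dir φ ∈ {η : Plane | ‖η‖ ≤ R} from hn.le.trans h2),
                Set.indicator_of_mem (show ρ ∈ Set.Ioc 0 R from ⟨h1, h2⟩)]
            · rw [Set.indicator_of_notMem (show ρ • dir φ ∉ {η : Plane | ‖η‖ ≤ R} from
                fun h : ‖ρ • dir φ‖ ≤ R => h2 (hn ▸ h)), mul_zero,
                Set.indicator_of_notMem (fun h => h2 h.2)]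
          · rw [Set.indicator_of_notMem h1, Set.indicator_of_notMem (fun h => h1 h.1)]
      _ ≤ _ := lintegral_ray_le hr hf hfi hfr hR φ
      _ ≤ _ := by
          gcongr
          · exact hmass f hfi hfr
          · exact energy_signedTransform_le hr hf hfr φ
  refine (lintegral_mono hray).trans (le_of_eq ?_)
  rw [lintegral_const_mul' _ _ ENNReal.ofReal_ne_top, lintegral_add_left measurable_const,
    setLIntegral_const, Real.volume_Ico, sub_zero, lintegral_const_mul' _ _ ENNReal.ofReal_ne_top,
    lintegral_const_mul' _ _ hC₂t]
  ring

end LowFrequency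

/-! ### Comparison of Fourier normalizations and Sobolev bounds. -/

section Sobolev

theorem fourierPlane_two_pi_smul (f : Plane → ℝ) (η : Plane) :
    fourierPlane f ((2 * Real.pi) • η) = (2 * (Real.pi : ℂ))⁻¹ * 𝓕 (fun x => (f x : ℂ)) η := by
  rw [fourierPlane, Real.fourier_eq']
  congr 1
  refine integral_congr_ae (Eventually.of_forall fun x => ?_)
  dsimp only
  rw [smul_eq_mul, mul_comm, inner_smul_right]
  congr 2
  push_cast
  ring

/-- Substitute `ξ = 2πη`: the Jacobian `(2π)²` cancels the squared prefactor of `fourierPlane`, so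
the two Sobolev norms agree without a constant. -/
theorem lintegral_fourierPlane (β : ℝ) (f : Plane → ℝ) :
    ∫⁻ ξ, ENNReal.ofReal ((1 + ‖ξ‖ ^ 2) ^ β * ‖fourierPlane f ξ‖ ^ 2) =
      sobolevSq β fun x => (f x : ℂ) := by
  have h2 : (2 * Real.pi) ≠ 0 := by positivity
  set G : Plane → ℝ≥0∞ := fun ξ => ENNReal.ofReal ((1 + ‖ξ‖ ^ 2) ^ β * ‖fourierPlane f ξ‖ ^ 2)
  have h1 : ∫⁻ η, G ((2 * Real.pi) • η) = ENNReal.ofReal ((2 * Real.pi) ^ 2)⁻¹ * ∫⁻ ξ, G ξ := by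
    have := (Homeomorph.smulOfNeZero (2 * Real.pi) h2 :
      Plane ≃ₜ Plane).measurableEmbedding.lintegral_map (μ := volume) G
    simp only [Homeomorph.smulOfNeZero_apply] at this
    rw [← this]
    have hmap : Measure.map (fun x : Plane => (2 * Real.pi) • x) volume =
        ENNReal.ofReal ((2 * Real.pi) ^ 2)⁻¹ • volume := by
      have := Measure.map_addHaar_smul (volume : Measure Plane) h2
      rw [finrank_euclideanSpace, Fintype.card_fin, abs_of_pos (by positivity)] at this
      exact this
    rw [hmap, lintegral_smul_measure, smul_eq_mul]
  have h3 : sobolevSq β (fun x => (f x : ℂ)) =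
      ENNReal.ofReal ((2 * Real.pi) ^ 2) * ∫⁻ η, G ((2 * Real.pi) • η) := by
    rw [sobolevSq, ← lintegral_const_mul' _ _ ENNReal.ofReal_ne_top]
    refine lintegral_congr fun η => ?_
    rw [← ENNReal.ofReal_mul (by positivity)]
    congr 1
    rw [fourierPlane_two_pi_smul, norm_mul, norm_smul, Real.norm_of_nonneg (by positivity)]
    have h4 : ‖(2 * (Real.pi : ℂ))⁻¹‖ = (2 * Real.pi)⁻¹ := by
      simp [abs_of_pos Real.pi_pos]
    rw [h4]
    field_simp
  rw [h3, h1, ← mul_assoc, ← ENNReal.ofReal_mul (by positivity), mul_inv_cancel₀ (by positivity)]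
  simp

theorem sobolevSq_le_of_sobolevNorm_le {β ρ : ℝ} (hρ : 0 ≤ ρ) {f : Plane → ℝ}
    (h : sobolevNorm β f ≤ ENNReal.ofReal ρ) :
    sobolevSq β (fun x => (f x : ℂ)) ≤ ENNReal.ofReal (ρ ^ 2) := by
  rw [sobolevNorm, lintegral_fourierPlane] at h
  rw [ENNReal.ofReal_pow hρ]
  calc sobolevSq β (fun x => (f x : ℂ))
      = (sobolevSq β (fun x => (f x : ℂ)) ^ (1 / 2 : ℝ)) ^ 2 := by
        rw [← ENNReal.rpow_natCast, ← ENNReal.rpow_mul]; simp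
    _ ≤ _ := by gcongr

theorem ofReal_le_two_mul_add_two_mul {a b c : ℝ} (ha : 0 ≤ a) (hb : 0 ≤ b)
    (h : c ≤ 2 * a + 2 * b) :
    ENNReal.ofReal c ≤ 2 * ENNReal.ofReal a + 2 * ENNReal.ofReal b := by
  rw [show (2 : ℝ≥0∞) = ENNReal.ofReal 2 by simp, ← ENNReal.ofReal_mul (by norm_num),
    ← ENNReal.ofReal_mul (by norm_num), ← ENNReal.ofReal_add (by positivity) (by positivity)]
  exact ENNReal.ofReal_le_ofReal h

theorem sobolevSq_sub_le (β : ℝ) (f g : 𝓢(Plane, ℂ)) :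
    sobolevSq β (⇑(f - g)) ≤ 2 * sobolevSq β f + 2 * sobolevSq β g := by
  have hF : ∀ η, 𝓕 (⇑(f - g)) η = 𝓕 (⇑f) η - 𝓕 (⇑g) η := by
    intro η
    have : 𝓕 (f - g) = 𝓕 f - 𝓕 g := by
      simpa using (FourierTransform.fourierCLM ℂ 𝓢(Plane, ℂ)).map_sub f g
    rw [← SchwartzMap.fourier_coe, this, sub_apply, SchwartzMap.fourier_coe,
      SchwartzMap.fourier_coe]
  have hc : Continuous (𝓕 (⇑f)) := by
    rw [← SchwartzMap.fourier_coe]; exact SchwartzMap.continuous _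
  have hw : Continuous fun η : Plane => (1 + (2 * Real.pi * ‖η‖) ^ 2) ^ β :=
    Continuous.rpow_const (by fun_prop) fun η => Or.inl (by positivity)
  have hm : Measurable fun η : Plane =>
      ENNReal.ofReal ((1 + (2 * Real.pi * ‖η‖) ^ 2) ^ β * ‖𝓕 (⇑f) η‖ ^ 2) :=
    (hw.mul (hc.norm.pow 2)).measurable.ennreal_ofReal
  rw [sobolevSq, sobolevSq, sobolevSq, ← lintegral_const_mul _ hm,
    ← lintegral_const_mul' _ _ (by norm_num), ← lintegral_add_left (hm.const_mul 2)]
  refine lintegral_mono fun η => ?_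
  rw [hF]
  refine ofReal_le_two_mul_add_two_mul (by positivity) (by positivity) ?_
  have h1 := norm_sub_le (𝓕 (⇑f) η) (𝓕 (⇑g) η)
  have h2 : ‖𝓕 (⇑f) η - 𝓕 (⇑g) η‖ ^ 2 ≤ 2 * ‖𝓕 (⇑f) η‖ ^ 2 + 2 * ‖𝓕 (⇑g) η‖ ^ 2 := by
    refine (pow_le_pow_left₀ (norm_nonneg _) h1 2).trans ?_
    nlinarith [sq_nonneg (‖𝓕 (⇑f) η‖ - ‖𝓕 (⇑g) η‖)]
  calc _ ≤ (1 + (2 * Real.pi * ‖η‖) ^ 2) ^ β * (2 * ‖𝓕 (⇑f) η‖ ^ 2 + 2 * ‖𝓕 (⇑g) η‖ ^ 2) := by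
        gcongr
    _ = _ := by ring

theorem energy_le_sobolevSq {β : ℝ} (hβ : 0 ≤ β) (f : 𝓢(Plane, ℂ)) :
    energy volume f ≤ sobolevSq β f := by
  rw [← energy_fourier_schwartz, energy, sobolevSq]
  refine lintegral_mono fun η => ENNReal.ofReal_le_ofReal ?_
  refine le_mul_of_one_le_left (by positivity) (Real.one_le_rpow ?_ hβ)
  nlinarith [sq_nonneg (2 * Real.pi * ‖η‖)]

end Sobolev

/-! ### The stability estimate for a single test function, and differences. -/

section TestFunction

variable {r : ℝ} {f : Plane → ℝ}

theorem hasCompactSupport_ofReal (hc : HasCompactSupport f) :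
    HasCompactSupport fun x => (f x : ℂ) :=
  hc.comp_left Complex.ofReal_zero

theorem contDiff_ofReal (hf : ContDiff ℝ ∞ f) : ContDiff ℝ ∞ fun x => (f x : ℂ) :=
  Complex.ofRealCLM.contDiff.comp hf

theorem IsTestFunction.eq_zero {Ω : Set Plane} (hf : IsTestFunction Ω f) {x : Plane}
    (hx : x ∉ Ω) : f x = 0 :=
  image_eq_zero_of_notMem_tsupport fun h => hx (hf.2.2 h)

theorem IsTestFunction.integrable {Ω : Set Plane} (hf : IsTestFunction Ω f) : Integrable f :=
  hf.1.continuous.integrable_of_hasCompactSupport hf.2.1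

theorem IsTestFunction.sub {Ω : Set Plane} {g : Plane → ℝ} (hf : IsTestFunction Ω f)
    (hg : IsTestFunction Ω g) : IsTestFunction Ω (f - g) := by
  have hsub : tsupport (f - g) ⊆ tsupport f ∪ tsupport g := by
    refine closure_minimal (fun x hx => ?_) ((isClosed_tsupport f).union (isClosed_tsupport g))
    by_contra h
    rw [Set.mem_union, not_or] at h
    exact hx (by simp [image_eq_zero_of_notMem_tsupport h.1, image_eq_zero_of_notMem_tsupport h.2])
  refine ⟨hf.1.sub hg.1, ?_, hsub.trans (Set.union_subset hf.2.2 hg.2.2)⟩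
  exact (hf.2.1.isCompact.union hg.2.1.isCompact).of_isClosed_subset (isClosed_tsupport _) hsub

/-- A cutoff equal to `|x|⁴` on the support of test functions, and vanishing near the origin. -/
theorem exists_cutoff (hr : 1 < r) : ∃ w : Plane → ℝ, ContDiff ℝ ∞ w ∧ HasCompactSupport w ∧
    0 ∉ tsupport w ∧ ∀ x ∈ ringDisc r, w x = ‖x‖ ^ 4 := by
  let c : Plane := !₂[0, (r + 1) / 2]
  -- The inner ball contains the support disc, and the outer radius `r/2` is less than the distance
  -- `(r+1)/2` from the centre to the origin.
  let B : ContDiffBump c := ⟨(r - 1) / 2, r / 2, by linarith, by linarith⟩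
  have hn : ContDiff ℝ ∞ fun x : Plane => ‖x‖ ^ 4 := by
    have : (fun x : Plane => ‖x‖ ^ 4) = fun x => (‖x‖ ^ 2) ^ 2 := by ext x; ring
    rw [this]
    exact (contDiff_norm_sq ℝ).pow 2
  refine ⟨fun x => B x * ‖x‖ ^ 4, B.contDiff.mul hn, B.hasCompactSupport.mul_right, ?_, ?_⟩
  · intro h
    have h1 := tsupport_mul_subset_left h
    rw [B.tsupport_eq, Metric.mem_closedBall, dist_comm, dist_zero_right] at h1
    have h2 : ‖c‖ ^ 2 = ((r + 1) / 2) ^ 2 := by rw [norm_sq_eq_coord]; simp [c]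
    have h3 : ‖c‖ ≤ r / 2 := h1
    nlinarith [norm_nonneg c]
  · intro x hx
    have h : x 0 ^ 2 + (x 1 - (r + 1) / 2) ^ 2 < (r - 1) ^ 2 / 4 := hx
    have h1 : x ∈ Metric.closedBall c B.rIn := by
      rw [mem_closedBall_iff_norm]
      refine (sq_le_sq₀ (norm_nonneg _) B.rIn_pos.le).1 ?_
      rw [norm_sq_eq_coord]
      simp only [c, B, PiLp.sub_apply]
      simp
      nlinarith
    change B x * ‖x‖ ^ 4 = ‖x‖ ^ 4
    rw [B.one_of_mem_closedBall h1, one_mul]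

/-- After the change of variables the right-hand integrand is `‖x‖⁴ |f x|²`, and `‖x‖ > 1` on the
support disc. -/
theorem energy_le_energy_pull (hr : 1 < r) (hf : IsTestFunction (ringDisc r) f) :
    energy volume f ≤ energy volume (pull f) := by
  rw [energy, energy, ← lintegral_comp_inv fun y => ENNReal.ofReal (‖pull f y‖ ^ 2)]
  refine lintegral_mono fun x => ?_
  rw [← ENNReal.ofReal_mul (by positivity)]
  refine ENNReal.ofReal_le_ofReal ?_
  by_cases hx : x ∈ ringDisc r
  · have h1 := one_lt_norm_of_mem_ringDisc hr hx
    have h0 : ‖x‖ ≠ 0 := by positivity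
    rw [pull, inv_inv, Complex.norm_real, norm_mul, norm_pow, norm_norm, mul_pow, ← mul_assoc]
    refine le_mul_of_one_le_left (by positivity) ?_
    have : ‖x‖⁻¹ ^ 4 * (‖x‖ ^ 4) ^ 2 = ‖x‖ ^ 4 := by field_simp
    rw [this]
    exact one_le_pow₀ h1.le
  · rw [hf.eq_zero hx, norm_zero, zero_pow two_ne_zero]
    positivity

/-- The `L²` norm of a test function is controlled by its disc transform and its Sobolev norm. -/
theorem exists_energy_le (hr : 1 < r) {β : ℝ} (hβ0 : 0 < β) (hβ1 : β < 1) :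
    ∃ C : ℝ, 0 ≤ C ∧ ∀ f : Plane → ℝ, IsTestFunction (ringDisc r) f → ∀ R : ℝ, 1 ≤ R →
      energy volume f ≤ ENNReal.ofReal (C * R ^ 3) * energy cylMeasure (discTransform f) +
        ENNReal.ofReal (C * R ^ (-2 * β)) * sobolevSq β fun x => (f x : ℂ) := by
  obtain ⟨w, hw, hwc, hw0, hwr⟩ := exists_cutoff hr
  obtain ⟨C₁, hC₁, htail⟩ := exists_tail_transplant_le hw hwc hw0 hβ0 hβ1
  obtain ⟨C₂, hC₂, hlow⟩ := exists_low_frequency_le hr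
  refine ⟨C₂.toReal + C₁, by positivity, fun f hf R hR => ?_⟩
  have hR0 : 0 < R := by linarith
  set F : 𝓢(Plane, ℂ) :=
    (hasCompactSupport_ofReal hf.2.1).toSchwartzMap (contDiff_ofReal hf.1)
  -- The cutoff equals `‖x‖⁴` where `f` lives, so it supplies the weight of `pull` while staying
  -- smooth.
  have hpull : pull f = ⇑(transplant hw hwc hw0 F) := by
    ext y
    rw [coe_transplant, Function.comp_apply, pull]
    have hFv : F (inv y) = (f (inv y) : ℂ) := rfl
    rw [hFv]
    by_cases hy : inv y ∈ ringDisc r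
    · rw [hwr _ hy, Complex.real_smul, Complex.ofReal_mul]
    · rw [hf.eq_zero hy]; simp
  have hcont : Continuous (𝓕 (pull f)) := by
    rw [hpull, ← SchwartzMap.fourier_coe]; exact SchwartzMap.continuous _
  have h1 := hlow f hf.1.continuous.measurable hf.integrable (fun x hx => hf.eq_zero hx) hcont R hR
  have h2 := htail F R hR
  rw [← hpull] at h2
  have hm : MeasurableSet {η : Plane | ‖η‖ ≤ R} :=
    (isClosed_le continuous_norm continuous_const).measurableSet
  have hcompl : {η : Plane | ‖η‖ ≤ R}ᶜ = {η : Plane | R < ‖η‖} := by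
    ext η; simp
  have hsplit := lintegral_add_compl (μ := (volume : Measure Plane))
    (fun η => ENNReal.ofReal (‖𝓕 (pull f) η‖ ^ 2)) hm
  rw [hcompl] at hsplit
  have hen : energy volume (pull f) = energy volume (𝓕 (pull f)) := by
    rw [hpull, energy_fourier_schwartz]
  have hFs : ⇑F = fun x => (f x : ℂ) := rfl
  rw [hFs] at h2
  refine (energy_le_energy_pull hr hf).trans ?_
  rw [hen, energy, ← hsplit]
  refine add_le_add (h1.trans ?_) (h2.trans ?_)
  · refine mul_le_mul_left ?_ _
    rw [ENNReal.ofReal_mul (by positivity)]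
    refine mul_le_mul_left ?_ _
    rw [ENNReal.ofReal_add ENNReal.toReal_nonneg hC₁, ENNReal.ofReal_toReal hC₂]
    exact le_self_add
  · refine mul_le_mul_left (ENNReal.ofReal_le_ofReal ?_) _
    have : 0 ≤ R ^ (-2 * β) := by positivity
    nlinarith [ENNReal.toReal_nonneg (a := C₂)]

theorem D1zero_sub {g : Plane → ℝ} (hf : Integrable f) (hg : Integrable g) (φ : ℝ) :
    D1zero (f - g) φ = D1zero f φ - D1zero g φ := by
  rw [D1zero_eq hf, D1zero_eq hg, D1zero_eq (hf.sub hg)]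
  exact integral_sub hf.integrableOn hg.integrableOn

theorem D1_sub {g : Plane → ℝ} (hf : Integrable f) (hg : Integrable g) (p φ : ℝ) :
    D1 (f - g) p φ = D1 f p φ - D1 g p φ :=
  integral_sub hf.integrableOn hg.integrableOn

theorem discTransform_sub {g : Plane → ℝ} (hf : Integrable f) (hg : Integrable g) :
    discTransform (f - g) = discTransform f - discTransform g := by
  ext z
  simp only [Pi.sub_apply, discTransform, D2, jump, D1zero_sub hf hg, D1_sub hf hg]
  split_ifs <;> ring

theorem energy_discTransform_sub_le {f₁ f₂ : Plane → ℝ} {gε : ℝ × ℝ → ℝ} {ε : ℝ} (hε : 0 ≤ ε)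
    (hr : 1 < r) (hg : AEStronglyMeasurable gε cylMeasure)
    (hf₁ : IsTestFunction (ringDisc r) f₁) (hf₂ : IsTestFunction (ringDisc r) f₂)
    (h₁ : eLpNorm (discTransform f₁ - gε) 2 cylMeasure ≤ ENNReal.ofReal ε)
    (h₂ : eLpNorm (discTransform f₂ - gε) 2 cylMeasure ≤ ENNReal.ofReal ε) :
    energy cylMeasure (discTransform (f₁ - f₂)) ≤ ENNReal.ofReal (4 * ε ^ 2) := by
  have hmeas : ∀ f, IsTestFunction (ringDisc r) f →
      AEStronglyMeasurable (discTransform f) cylMeasure := fun f hf =>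
    (aemeasurable_discTransform hf.1.continuous.measurable hf.integrable
      (hf.eq_zero fun h => ne_zero_of_mem_ringDisc hr h rfl)).aestronglyMeasurable.restrict
  have heq : discTransform (f₁ - f₂) = (discTransform f₁ - gε) - (discTransform f₂ - gε) := by
    rw [discTransform_sub hf₁.integrable hf₂.integrable]; abel
  have hle : eLpNorm (discTransform (f₁ - f₂)) 2 cylMeasure ≤ ENNReal.ofReal (2 * ε) := by
    rw [heq, two_mul, ENNReal.ofReal_add hε hε]
    exact (eLpNorm_sub_le ((hmeas f₁ hf₁).sub hg) ((hmeas f₂ hf₂).sub hg) (by norm_num)).trans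
      (add_le_add h₁ h₂)
  rw [energy_eq_eLpNorm_sq]
  calc _ ≤ ENNReal.ofReal (2 * ε) ^ 2 := by gcongr
    _ = _ := by rw [← ENNReal.ofReal_pow (by positivity)]; congr 1; ring

theorem sobolevSq_sub_le_of_sobolevNorm_le {Ω : Set Plane} {f₁ f₂ : Plane → ℝ} {β ρ : ℝ}
    (hρ : 0 ≤ ρ) (hf₁ : IsTestFunction Ω f₁) (hf₂ : IsTestFunction Ω f₂)
    (h₁ : sobolevNorm β f₁ ≤ ENNReal.ofReal ρ) (h₂ : sobolevNorm β f₂ ≤ ENNReal.ofReal ρ) :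
    sobolevSq β (fun x => ((f₁ - f₂) x : ℂ)) ≤ ENNReal.ofReal (4 * ρ ^ 2) := by
  have h := sobolevSq_sub_le β
    ((hasCompactSupport_ofReal hf₁.2.1).toSchwartzMap (contDiff_ofReal hf₁.1))
    ((hasCompactSupport_ofReal hf₂.2.1).toSchwartzMap (contDiff_ofReal hf₂.1))
  have heq : (fun x => ((f₁ - f₂) x : ℂ)) =
      ⇑((hasCompactSupport_ofReal hf₁.2.1).toSchwartzMap (contDiff_ofReal hf₁.1) -
        (hasCompactSupport_ofReal hf₂.2.1).toSchwartzMap (contDiff_ofReal hf₂.1)) := by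
    ext x
    simp
  rw [heq]
  have e₁ := sobolevSq_le_of_sobolevNorm_le hρ h₁
  have e₂ := sobolevSq_le_of_sobolevNorm_le hρ h₂
  calc _ ≤ _ := h
    _ ≤ 2 * ENNReal.ofReal (ρ ^ 2) + 2 * ENNReal.ofReal (ρ ^ 2) :=
        add_le_add (mul_le_mul_right e₁ 2) (mul_le_mul_right e₂ 2)
    _ = _ := by
        rw [← add_mul, ENNReal.ofReal_mul (by norm_num)]
        norm_num

end TestFunction

/-! ### Choice of the cutoff frequency and conclusion. -/

/-- The value of the two error terms at the optimal cutoff frequency. -/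
theorem optimal_cutoff {β ρ ε : ℝ} (hβ : 0 < β) (hε : 0 < ε) (hρ : 0 < ρ) :
    ((ρ / ε) ^ (1 / (β + 3 / 2))) ^ 3 * ε ^ 2 =
        (ρ ^ ((3 / 2) / (β + 3 / 2)) * ε ^ (β / (β + 3 / 2))) ^ 2 ∧
      ((ρ / ε) ^ (1 / (β + 3 / 2))) ^ (-2 * β) * ρ ^ 2 =
        (ρ ^ ((3 / 2) / (β + 3 / 2)) * ε ^ (β / (β + 3 / 2))) ^ 2 := by
  have hb : β + 3 / 2 ≠ 0 := by positivity
  have hd : 0 < ρ / ε := by positivity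
  constructor
  · rw [mul_pow, ← Real.rpow_natCast, ← Real.rpow_natCast, ← Real.rpow_natCast,
      ← Real.rpow_natCast, ← Real.rpow_mul hd.le, ← Real.rpow_mul hρ.le, ← Real.rpow_mul hε.le,
      Real.div_rpow hρ.le hε.le, div_mul_eq_mul_div, mul_div_assoc, ← Real.rpow_sub hε]
    congr 2 <;> (push_cast; field_simp)
    ring
  · rw [mul_pow, ← Real.rpow_natCast, ← Real.rpow_natCast, ← Real.rpow_natCast,
      ← Real.rpow_mul hd.le, ← Real.rpow_mul hρ.le, ← Real.rpow_mul hε.le,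
      Real.div_rpow hρ.le hε.le, div_mul_eq_mul_div, mul_div_right_comm, div_eq_mul_inv,
      ← Real.rpow_neg hε.le, mul_right_comm, ← Real.rpow_add hρ]
    congr 2 <;> (push_cast; field_simp)
    ring

end DiscTransform

end

theorem mainTheorem7 (r : ℝ) (hr : 1 < r) (β : ℝ) (hβ0 : 0 < β) (hβ1 : β < 1) :
    ∃ c : ℝ, 0 < c ∧
      ∀ (ρ ε : ℝ) (f f₁ f₂ : DiscTransform.Plane → ℝ) (gε : ℝ × ℝ → ℝ),
        0 ≤ ρ →
        DiscTransform.IsTestFunction (DiscTransform.ringDisc r) f →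
        MemLp gε 2 DiscTransform.cylMeasure →
        eLpNorm (gε - DiscTransform.discTransform f) 2 DiscTransform.cylMeasure
          < ENNReal.ofReal ε →
        DiscTransform.IsTestFunction (DiscTransform.ringDisc r) f₁ →
        DiscTransform.IsTestFunction (DiscTransform.ringDisc r) f₂ →
        eLpNorm (DiscTransform.discTransform f₁ - gε) 2 DiscTransform.cylMeasure
          < ENNReal.ofReal ε →
        eLpNorm (DiscTransform.discTransform f₂ - gε) 2 DiscTransform.cylMeasure
          < ENNReal.ofReal ε →
        DiscTransform.sobolevNorm β f₁ ≤ ENNReal.ofReal ρ →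
        DiscTransform.sobolevNorm β f₂ ≤ ENNReal.ofReal ρ →
        eLpNorm (f₁ - f₂) 2 volume
          ≤ ENNReal.ofReal
              (c * ρ ^ ((3 / 2) / (β + 3 / 2)) * ε ^ (β / (β + 3 / 2))) := by
  open DiscTransform in
  obtain ⟨C, hC, hmain⟩ := exists_energy_le hr hβ0 hβ1
  -- The two cases below need the constants `√(8C)` and 2; their sum serves both and is positive
  -- even if `C = 0`.
  refine ⟨Real.sqrt (8 * C) + 2, by positivity, ?_⟩
  intro ρ ε f f₁ f₂ gε hρ _ hg _ hf₁ hf₂ h₁ h₂ hs₁ hs₂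
  -- The strict inequality on the data forces `ε > 0`.
  have hε : 0 < ε := ENNReal.ofReal_pos.1 (bot_le.trans_lt h₁)
  have hE := energy_discTransform_sub_le hε.le hr hg.aestronglyMeasurable hf₁ hf₂ h₁.le h₂.le
  have hS := sobolevSq_sub_le_of_sobolevNorm_le hρ hf₁ hf₂ hs₁ hs₂
  have hf := hf₁.sub hf₂
  set X : ℝ := ρ ^ ((3 / 2) / (β + 3 / 2)) * ε ^ (β / (β + 3 / 2)) with hX
  have hX0 : 0 ≤ X := by positivity
  have hgoal : ∀ c : ℝ, 0 ≤ c → c ≤ Real.sqrt (8 * C) + 2 →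
      energy volume (f₁ - f₂) ≤ ENNReal.ofReal ((c * X) ^ 2) → eLpNorm (f₁ - f₂) 2 volume ≤
        ENNReal.ofReal ((Real.sqrt (8 * C) + 2) * ρ ^ ((3 / 2) / (β + 3 / 2)) *
          ε ^ (β / (β + 3 / 2))) := by
    intro c hc hcC h
    rw [energy_eq_eLpNorm_sq, ENNReal.ofReal_pow (by positivity)] at h
    refine (le_of_not_gt fun hlt => h.not_gt (ENNReal.pow_lt_pow_left two_ne_zero hlt)).trans ?_
    rw [mul_assoc]
    gcongr
  -- The optimal frequency is at least 1 only if `ε ≤ ρ`. Otherwise `ρ ≤ X`, and the `L²` norm is at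
  -- most the Sobolev norm, hence at most `2ρ`.
  rcases le_or_gt ρ ε with hle | hlt
  · refine hgoal 2 (by norm_num) (by linarith [Real.sqrt_nonneg (8 * C)]) ?_
    have hρX : ρ ≤ X := by
      have hsum : (3 / 2) / (β + 3 / 2) + β / (β + 3 / 2) = 1 := by field_simp; ring
      calc ρ = ρ ^ ((3 / 2) / (β + 3 / 2)) * ρ ^ (β / (β + 3 / 2)) := by
            rw [← Real.rpow_add_of_nonneg hρ (by positivity) (by positivity), hsum, Real.rpow_one]
        _ ≤ X := by rw [hX]; gcongr
    have h1 : energy volume (f₁ - f₂) ≤ sobolevSq β fun x => ((f₁ - f₂) x : ℂ) := by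
      rw [energy_congr (v := fun x => ((f₁ - f₂) x : ℂ)) fun x => (Complex.norm_real _).symm]
      exact energy_le_sobolevSq hβ0.le
        ((hasCompactSupport_ofReal hf.2.1).toSchwartzMap (contDiff_ofReal hf.1))
    refine h1.trans (hS.trans (ENNReal.ofReal_le_ofReal ?_))
    nlinarith
  · refine hgoal (Real.sqrt (8 * C)) (Real.sqrt_nonneg _) (by linarith) ?_
    have hρ0 : 0 < ρ := hε.trans hlt
    have hR : 1 ≤ (ρ / ε) ^ (1 / (β + 3 / 2)) :=
      Real.one_le_rpow ((one_le_div hε).2 hlt.le) (by positivity)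
    obtain ⟨o₁, o₂⟩ := optimal_cutoff hβ0 hε hρ0
    have := hmain _ hf _ hR
    set R := (ρ / ε) ^ (1 / (β + 3 / 2))
    have hR0 : 0 < R := by linarith
    calc _ ≤ _ := this
      _ ≤ ENNReal.ofReal (C * R ^ 3) * ENNReal.ofReal (4 * ε ^ 2) +
          ENNReal.ofReal (C * R ^ (-2 * β)) * ENNReal.ofReal (4 * ρ ^ 2) :=
          add_le_add (mul_le_mul_right hE _) (mul_le_mul_right hS _)
      _ = ENNReal.ofReal ((Real.sqrt (8 * C) * X) ^ 2) := by
          rw [← ENNReal.ofReal_mul (by positivity), ← ENNReal.ofReal_mul (by positivity),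
            ← ENNReal.ofReal_add (by positivity) (by positivity), mul_pow,
            Real.sq_sqrt (by positivity)]
          congr 1
          -- At the optimal cutoff both error terms equal `4 C X²`, whence the 8.
          linear_combination 4 * C * o₁ + 4 * C * o₂
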